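/- Consider the following three-user memoryless interference channel with feedback, in which all inputs and outputs are bits and $\oplus$ is addition modulo $2$. Let $p,\delta,\epsilon\in[0,1]$. In each channel use, transmitter $1$ sends $(X_{11},X_{12})$, transmitter $2$ sends $X_2$, and transmitter $3$ sends $(X_{32},X_{33})$; receiver $1$ observes $Y_1=X_{11}\oplus N_p$, receiver $2$ observes $(Y_2,Y_2')$ with $$Y_2=X_2\oplus N_p,\qquad Y_2'=X_{12}\oplus N_\delta\oplus\big((X_{12}\oplus X_{32})\wedge E\big),$$ and receiver $3$ observes $Y_3=X_{33}\oplus N_p\oplus N_\epsilon$. Here $N_p,N_\delta,E,N_\epsilon$ are mutually independent Bernoulli variables with parameters $p,\delta,\tfrac12,\epsilon$, independent over the channel uses, and $N_p$ is the same variable in all three outputs. Transmitters $1$ and $3$ receive, with one unit of delay, the noiseless feedback $Z_1=Y_1$ and $Z_3=Y_3$; transmitter $2$ receives no feedback. An $(M_1,M_2,M_3,N)$ feedback-block-code, with positive integers $M_1,M_2,M_3,N$, consists of encoding functions $f_{i,n}:\{1,\dots,M_i\}\times\mathcal Z_i^{n-1}\to\mathcal X_i$ for $1\le n\le N$ (where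 $\mathcal X_i$, $\mathcal Y_i$ and $\mathcal Z_i$ denote the alphabets of the inputs of transmitter $i$, of the observations of receiver $i$, and of the feedback to transmitter $i$) and decoding functions $g_i:\mathcal Y_i^N\to\{1,\dots,M_i\}$, $i=1,2,3$. Its error probability $P_e$ is the probability that at least one of the three messages is decoded incorrectly, when the messages are independent and uniformly distributed. A triple $(R_1,R_2,R_3)\in\mathbb R^3$ is $\eta$-achievable by the code if $P_e\le\eta$ and $\frac1N\log_2 M_i\ge R_i-\eta$ for $i=1,2,3$. It is $\eta$-achievable by a randomized coding strategy, that is, by a probability measure on the triples of encoding functions with parameters $(M_1,M_2,M_3,N)$, if with probability one the encoding functions can be completed by decoding functions to a code by which the triple is $\eta$-achievable. It is $\eta$-achievable if it is $\eta$-achievable by some feedback-block-code or by some randomized coding strategy. The feedback capacity is the set of all triples that are $\eta$-achievable for every $\eta>0$. Let $h(x)=-x\log_2x-(1-x)\log_2(1-x)$ be the binary entropy function. If $h(p)\le 1-h(\delta)$ and $\epsilon=0$, then the feedback capacity of this channel is exactly the set of all $(R_1,R_2,R_3)\in\mathbb R^3$ with $$R_1\le 1-h(p),\qquad R_2\le 1,\qquad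 R_3\le 1-h(p).$$ -/

import Mathlib

noncomputable section

namespace ICFB

/-- A three-user memoryless interference channel with generalized feedback: `Q` is the transition
law from the channel inputs to the channel outputs, and `P` the transition law from the channel
outputs to the feedback symbols. -/
structure Channel (X₁ X₂ X₃ Y₁ Y₂ Y₃ Z₁ Z₂ Z₃ : Type) where
  Q : X₁ × X₂ × X₃ → PMF (Y₁ × Y₂ × Y₃)
  P : Y₁ × Y₂ × Y₃ → PMF (Z₁ × Z₂ × Z₃)

/-- The encoding functions of one transmitter with `M` messages and `N` channel uses: the `n`-th
input (counted from `0`) is computed from the message and the feedback symbols at the times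
`0, …, n - 1`. -/
abbrev Encoder (M N : ℕ) (Z X : Type) : Type :=
  (n : Fin N) → Fin M → (Fin (n : ℕ) → Z) → X

/-- A decoding function of one receiver. -/
abbrev Decoder (M N : ℕ) (Y : Type) : Type :=
  (Fin N → Y) → Fin M

/-- The encoding functions of the three transmitters. -/
structure Encoders (X₁ X₂ X₃ Z₁ Z₂ Z₃ : Type) (M₁ M₂ M₃ N : ℕ) where
  f₁ : Encoder M₁ N Z₁ X₁
  f₂ : Encoder M₂ N Z₂ X₂
  f₃ : Encoder M₃ N Z₃ X₃

/-- The decoding functions of the three receivers. -/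
structure Decoders (Y₁ Y₂ Y₃ : Type) (M₁ M₂ M₃ N : ℕ) where
  g₁ : Decoder M₁ N Y₁
  g₂ : Decoder M₂ N Y₂
  g₃ : Decoder M₃ N Y₃

/-- A feedback-block-code. -/
structure FeedbackBlockCode (X₁ X₂ X₃ Y₁ Y₂ Y₃ Z₁ Z₂ Z₃ : Type) (M₁ M₂ M₃ N : ℕ) where
  enc : Encoders X₁ X₂ X₃ Z₁ Z₂ Z₃ M₁ M₂ M₃ N
  dec : Decoders Y₁ Y₂ Y₃ M₁ M₂ M₃ N

section General

variable {X₁ X₂ X₃ Y₁ Y₂ Y₃ Z₁ Z₂ Z₃ : Type} {M₁ M₂ M₃ N : ℕ}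

/-- The first `n` terms of a sequence of length `N`. -/
def past {Z : Type} (z : Fin N → Z) (n : Fin N) : Fin (n : ℕ) → Z :=
  fun k => z (Fin.castLE n.is_lt.le k)

/-- The channel inputs at time `n` when the messages are `w` and the feedback is `z`. -/
def Encoders.input (f : Encoders X₁ X₂ X₃ Z₁ Z₂ Z₃ M₁ M₂ M₃ N)
    (w : Fin M₁ × Fin M₂ × Fin M₃) (z : Fin N → Z₁ × Z₂ × Z₃) (n : Fin N) : X₁ × X₂ × X₃ :=
  (f.f₁ n w.1 (past (fun k => (z k).1) n),
    f.f₂ n w.2.1 (past (fun k => (z k).2.1) n),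
    f.f₃ n w.2.2 (past (fun k => (z k).2.2) n))

/-- The probability that the outputs are `y` and the feedback is `z` over `N` uses of the
memoryless channel, given the messages `w`. -/
def Channel.prob (C : Channel X₁ X₂ X₃ Y₁ Y₂ Y₃ Z₁ Z₂ Z₃)
    (f : Encoders X₁ X₂ X₃ Z₁ Z₂ Z₃ M₁ M₂ M₃ N) (w : Fin M₁ × Fin M₂ × Fin M₃)
    (y : Fin N → Y₁ × Y₂ × Y₃) (z : Fin N → Z₁ × Z₂ × Z₃) : ℝ :=
  ∏ n : Fin N, (C.Q (f.input w z n) (y n)).toReal * (C.P (y n) (z n)).toReal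

/-- The decoded messages. -/
def Decoders.decode (g : Decoders Y₁ Y₂ Y₃ M₁ M₂ M₃ N) (y : Fin N → Y₁ × Y₂ × Y₃) :
    Fin M₁ × Fin M₂ × Fin M₃ :=
  (g.g₁ fun k => (y k).1, g.g₂ fun k => (y k).2.1, g.g₃ fun k => (y k).2.2)

variable [Fintype Y₁] [Fintype Y₂] [Fintype Y₃] [Fintype Z₁] [Fintype Z₂] [Fintype Z₃]

/-- The probability that some message is decoded incorrectly, for independent and uniformly
distributed messages. -/
def Channel.errorProb (C : Channel X₁ X₂ X₃ Y₁ Y₂ Y₃ Z₁ Z₂ Z₃)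
    (c : FeedbackBlockCode X₁ X₂ X₃ Y₁ Y₂ Y₃ Z₁ Z₂ Z₃ M₁ M₂ M₃ N) : ℝ :=
  ∑ w : Fin M₁ × Fin M₂ × Fin M₃, (1 / ((M₁ : ℝ) * M₂ * M₃)) *
    ∑ y : Fin N → Y₁ × Y₂ × Y₃, ∑ z : Fin N → Z₁ × Z₂ × Z₃,
      if c.dec.decode y ≠ w then C.prob c.enc w y z else 0

/-- The rate triple `R` is `ε`-achievable by the feedback-block-code `c`. -/
def Channel.AchievableByCode (C : Channel X₁ X₂ X₃ Y₁ Y₂ Y₃ Z₁ Z₂ Z₃)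
    (c : FeedbackBlockCode X₁ X₂ X₃ Y₁ Y₂ Y₃ Z₁ Z₂ Z₃ M₁ M₂ M₃ N) (ε : ℝ) (R : ℝ × ℝ × ℝ) :
    Prop :=
  C.errorProb c ≤ ε ∧
    R.1 - ε ≤ 1 / (N : ℝ) * Real.logb 2 M₁ ∧
    R.2.1 - ε ≤ 1 / (N : ℝ) * Real.logb 2 M₂ ∧
    R.2.2 - ε ≤ 1 / (N : ℝ) * Real.logb 2 M₃

/-- The rate triple `R` is `ε`-achievable by the randomized coding strategy `S`, a probability
measure on the encoding functions: with probability one, the encoding functions belong to a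
feedback-block-code for which `R` is `ε`-achievable. -/
def Channel.AchievableByStrategy (C : Channel X₁ X₂ X₃ Y₁ Y₂ Y₃ Z₁ Z₂ Z₃)
    (S : PMF (Encoders X₁ X₂ X₃ Z₁ Z₂ Z₃ M₁ M₂ M₃ N)) (ε : ℝ) (R : ℝ × ℝ × ℝ) : Prop :=
  S.toOuterMeasure {f | ∃ g : Decoders Y₁ Y₂ Y₃ M₁ M₂ M₃ N, C.AchievableByCode ⟨f, g⟩ ε R} = 1

/-- The rate triple `R` is `ε`-achievable. -/
def Channel.EpsAchievable (C : Channel X₁ X₂ X₃ Y₁ Y₂ Y₃ Z₁ Z₂ Z₃) (ε : ℝ) (R : ℝ × ℝ × ℝ) :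
    Prop :=
  ∃ M₁ M₂ M₃ N : ℕ, 0 < M₁ ∧ 0 < M₂ ∧ 0 < M₃ ∧ 0 < N ∧
    ((∃ c : FeedbackBlockCode X₁ X₂ X₃ Y₁ Y₂ Y₃ Z₁ Z₂ Z₃ M₁ M₂ M₃ N,
        C.AchievableByCode c ε R) ∨
      ∃ S : PMF (Encoders X₁ X₂ X₃ Z₁ Z₂ Z₃ M₁ M₂ M₃ N), C.AchievableByStrategy S ε R)

/-- The feedback-capacity: the set of all achievable rate triples. -/
def Channel.feedbackCapacity (C : Channel X₁ X₂ X₃ Y₁ Y₂ Y₃ Z₁ Z₂ Z₃) : Set (ℝ × ℝ × ℝ) :=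
  {R | ∀ ε : ℝ, 0 < ε → C.EpsAchievable ε R}

end General

/-- The law of a Bernoulli random variable (`true` stands for the bit `1`). -/
def bernoulli (p : unitInterval) : PMF Bool :=
  PMF.ofFintype (fun b => ENNReal.ofReal (if b then (p : ℝ) else 1 - (p : ℝ))) (by
    have h : (0 : ℝ) ≤ 1 - (p : ℝ) := sub_nonneg.2 p.2.2
    simp [← ENNReal.ofReal_add p.2.1 h])

/-- The example channel. The inputs are `(X₁₁, X₁₂)`, `X₂`, `(X₃₂, X₃₃)`, the outputs
`Y₁`, `(Y₂, Y₂')`, `Y₃`; all of them are bits, and `N_p`, `N_δ`, `E`, `N_ε` are independent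
Bernoulli variables with parameters `p`, `δ`, `1/2`, `ε`. The noise `N_p` is common to the three
outputs. Transmitters `1` and `3` receive noiseless feedback, transmitter `2` receives none. -/
def exampleChannel (p δ ε : unitInterval) :
    Channel (Bool × Bool) Bool (Bool × Bool) Bool (Bool × Bool) Bool Bool Unit Bool where
  Q := fun ⟨⟨x₁₁, x₁₂⟩, x₂, ⟨x₃₂, x₃₃⟩⟩ =>
    (bernoulli p).bind fun Np =>
    (bernoulli δ).bind fun Nδ =>
    (bernoulli ⟨1 / 2, by norm_num, by norm_num⟩).bind fun E =>
    (bernoulli ε).bind fun Nε =>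
      PMF.pure
        (xor x₁₁ Np,
          (xor x₂ Np, xor (xor x₁₂ Nδ) (xor x₁₂ x₃₂ && E)),
          xor (xor x₃₃ Np) Nε)
  P := fun y => PMF.pure (y.1, (), y.2.2)

/-- The binary entropy function, in bits. -/
def hb (p : ℝ) : ℝ := Real.binEntropy p / Real.log 2

end ICFB

end

/-!
Since `ε = 0`, transmitters `1` and `3` both learn the noise `N_p` from the feedback, while receivers
`1` and `3` just see binary symmetric channels with crossover probability `p`.

*Achievability.* Transmitter `2` sends uncoded bits, so receiver `2` needs nothing but the noise `N_p`
in order to read them. Transmission takes place in blocks. In each block the transmitters `1` and `3`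
compress the noise of the preceding block and send it, in cooperation, with the same inputs
`X₁₂ = X₃₂`; this cancels the term with `E`, and what remains is a binary symmetric channel with
crossover probability `δ`, whose capacity `1 - h(δ)` suffices for the `h(p)` bits of noise per channel
use (`blockMarkovCode`, `run_blockMarkovCode`). The compression and the code are obtained together
from one random coding argument (`exists_code_of_threshold`) with an exponential bound on the
error probability (`exists_transmissionError_le`). The source with parameter `1 / 2` is a uniform
message, so the same argument gives the codes for the receivers `1` and `3`.

*Converse.* For fixed messages, the output of receiver `1` or `3` and the sequence `N_p` determine each
other (`noiseEquiv`), hence the relative entropy between the law of the output and the uniform law is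
exactly `N (log 2 - H(p))`, with or without feedback, and data processing bounds the number of
messages (`log_card_le`). Transmitter `2` has only `2 ^ N` input sequences to choose from, which
bounds its number of messages (`converse_snd`). Randomized strategies add nothing, because they
are supported on encoding functions that are themselves good.

Entropies are computed in nats (`Real.binEntropy`) and converted to bits at the end.
-/

namespace ICFB

/-! ### Independent Bernoulli sequences -/

/-- The probability that a Bernoulli variable with parameter `p` takes the value `b`. -/
def bw (p : ℝ) (b : Bool) : ℝ := if b then p else 1 - p

/-- The probability of a sequence of independent Bernoulli variables with parameter `p`. -/
def seqW {ι : Type*} [Fintype ι] (p : ℝ) (s : ι → Bool) : ℝ := ∏ i, bw p (s i)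

theorem bw_nonneg (p : unitInterval) (b : Bool) : 0 ≤ bw p b := by
  cases b
  · simpa [bw] using p.2.2
  · simpa [bw] using p.2.1

theorem sum_bw (p : ℝ) : ∑ b, bw p b = 1 := by simp [bw]

theorem seqW_nonneg {ι : Type*} [Fintype ι] (p : unitInterval) (s : ι → Bool) :
    0 ≤ seqW (p : ℝ) s :=
  Finset.prod_nonneg fun _ _ => bw_nonneg _ _

theorem sum_prod_apply {ι : Type*} [Fintype ι] [DecidableEq ι] {A : Type*} [Fintype A]
    (g : ι → A → ℝ) : ∑ s : ι → A, ∏ i, g i (s i) = ∏ i, ∑ b, g i b := by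
  rw [Finset.prod_univ_sum, Fintype.piFinset_univ]

theorem sum_seqW {ι : Type*} [Fintype ι] [DecidableEq ι] (p : ℝ) :
    ∑ s : ι → Bool, seqW p s = 1 := by
  simp only [seqW]
  rw [sum_prod_apply fun _ => bw p]
  simp only [sum_bw, Finset.prod_const_one]

/-- The coordinates of an independent Bernoulli sequence along an injection form an independent
Bernoulli sequence. -/
theorem sum_seqW_comp {ι κ : Type*} [Fintype ι] [DecidableEq ι] [Fintype κ] [DecidableEq κ]
    (p : ℝ) (e : κ → ι) (he : Function.Injective e) (F : (κ → Bool) → ℝ) :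
    ∑ s : ι → Bool, seqW p s * F (s ∘ e) = ∑ t : κ → Bool, seqW p t * F t := by
  have h1 : ∀ s : ι → Bool, seqW p s * F (s ∘ e) =
      ∑ t : κ → Bool, F t * (seqW p s * if s ∘ e = t then 1 else 0) := by
    intro s
    simp [mul_comm]
  simp_rw [h1]
  rw [Finset.sum_comm]
  refine Finset.sum_congr rfl fun t _ => ?_
  rw [← Finset.mul_sum, mul_comm]
  congr 1
  have h2 : ∀ s : ι → Bool, (seqW p s * if s ∘ e = t then (1 : ℝ) else 0) =
      ∏ i, (bw p (s i) * if ∀ j, e j = i → s i = t j then 1 else 0) := by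
    intro s
    rw [Finset.prod_mul_distrib, Finset.prod_ite_zero]
    simp only [seqW, Finset.prod_const_one]
    congr 1
    refine if_congr ?_ rfl rfl
    simp only [funext_iff, Function.comp_apply, Finset.mem_univ, true_imp_iff]
    exact ⟨fun h i j hj => hj ▸ h j, fun h j => h _ j rfl⟩
  simp_rw [h2]
  rw [sum_prod_apply fun i b => bw p b * if ∀ j, e j = i → b = t j then (1 : ℝ) else 0]
  have h3 : ∀ i, i ∉ Finset.univ.image e →
      ∑ b, bw p b * (if ∀ j, e j = i → b = t j then (1 : ℝ) else 0) = 1 := by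
    intro i hi
    have : ∀ b, (∀ j, e j = i → b = t j) ↔ True := by
      intro b
      simp only [iff_true]
      intro j hj
      exact absurd (Finset.mem_image_of_mem e (Finset.mem_univ j)) (hj ▸ hi)
    simp only [this, if_true, mul_one, sum_bw]
  rw [← Finset.prod_subset (Finset.subset_univ (Finset.univ.image e)) fun i _ hi => h3 i hi,
    Finset.prod_image fun a _ b _ h => he h]
  refine Finset.prod_congr rfl fun j _ => ?_
  have : ∀ b, (∀ j', e j' = e j → b = t j') ↔ b = t j := by
    intro b
    constructor
    · intro h; exact h j rfl
    · intro h j' hj'; rw [h, he hj']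
  simp [this]

/-! ### The channel as a function of its noise -/

/-- A causal recursion has exactly one solution. -/
theorem existsUnique_causal {N : ℕ} {A : Type} (F : (n : Fin N) → (Fin (n : ℕ) → A) → A) :
    ∃! y : Fin N → A, ∀ n, y n = F n (past y n) := by
  have key : ∀ m : ℕ, ∀ hm : m ≤ N, ∃ y : Fin m → A, ∀ n : Fin m,
      y n = F (Fin.castLE hm n) (past y n) := by
    intro m
    induction m with
    | zero => intro _; exact ⟨Fin.elim0, fun n => n.elim0⟩
    | succ m ih =>
      intro hm
      obtain ⟨y, hy⟩ := ih (Nat.le_of_succ_le hm)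
      refine ⟨Fin.snoc y (F ⟨m, hm⟩ y), fun n => ?_⟩
      refine Fin.lastCases ?_ (fun n => ?_) n
      · rw [Fin.snoc_last]
        congr 1
        funext k
        exact (Fin.snoc_castSucc (α := fun _ => A) (F ⟨m, hm⟩ y) y k).symm
      · rw [Fin.snoc_castSucc, hy n]
        congr 1
        funext k
        exact (Fin.snoc_castSucc (α := fun _ => A) (F ⟨m, hm⟩ y) y
          (Fin.castLE n.is_lt.le k)).symm
  obtain ⟨y, hy⟩ := key N le_rfl
  refine ⟨y, hy, fun y' hy' => ?_⟩
  have : ∀ m : ℕ, ∀ hm : m < N, y' ⟨m, hm⟩ = y ⟨m, hm⟩ := by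
    intro m
    induction m using Nat.strong_induction_on with
    | _ m ih =>
      intro hm
      rw [hy' ⟨m, hm⟩, hy ⟨m, hm⟩]
      congr 1
      funext k
      exact ih k k.is_lt (lt_trans k.is_lt hm)
  funext n
  exact this n n.is_lt

/-- The outputs of the channel with `ε = 0`, as a function of the inputs and of the noise bits
`N_p`, `N_δ`, `E`. -/
def outputs (x : (Bool × Bool) × Bool × (Bool × Bool)) (u v e : Bool) :
    Bool × (Bool × Bool) × Bool :=
  (xor x.1.1 u, (xor x.2.1 u, xor (xor x.1.2 v) (xor x.1.2 x.2.2.1 && e)), xor x.2.2.2 u)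

/-- The feedback, as a function of the outputs. -/
def feedback (y : Bool × (Bool × Bool) × Bool) : Bool × Unit × Bool := (y.1, (), y.2.2)

theorem bernoulli_apply (p : unitInterval) (b : Bool) :
    bernoulli p b = ENNReal.ofReal (bw p b) := by
  simp [bernoulli, bw]

theorem exampleChannel_Q (p δ : unitInterval) (x : (Bool × Bool) × Bool × (Bool × Bool))
    (y : Bool × (Bool × Bool) × Bool) :
    ((exampleChannel p δ 0).Q x y).toReal =
      ∑ u, ∑ v, ∑ e, bw p u * bw δ v * bw (1 / 2) e * if y = outputs x u v e then 1 else 0 := by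
  obtain ⟨⟨x₁₁, x₁₂⟩, x₂, ⟨x₃₂, x₃₃⟩⟩ := x
  have h : ∀ b, (0 : ℝ) ≤ bw (1 / 2) b := by intro b; cases b <;> norm_num [bw]
  have key : (exampleChannel p δ 0).Q ((x₁₁, x₁₂), x₂, (x₃₂, x₃₃)) y =
      ENNReal.ofReal (∑ u, ∑ v, ∑ e, bw p u * bw δ v * bw (1 / 2) e *
        if y = outputs ((x₁₁, x₁₂), x₂, (x₃₂, x₃₃)) u v e then 1 else 0) := by
    have hk : ∀ u v e, 0 ≤ bw p u * bw δ v * bw (1 / 2) e *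
        if y = outputs ((x₁₁, x₁₂), x₂, (x₃₂, x₃₃)) u v e then (1 : ℝ) else 0 := by
      intro u v e
      have := bw_nonneg p u
      have := bw_nonneg δ v
      have := h e
      positivity
    rw [ENNReal.ofReal_sum_of_nonneg fun u _ => Finset.sum_nonneg fun v _ =>
      Finset.sum_nonneg fun e _ => hk u v e]
    simp only [exampleChannel, PMF.bind_apply, tsum_fintype]
    refine Finset.sum_congr rfl fun u _ => ?_
    rw [ENNReal.ofReal_sum_of_nonneg fun v _ => Finset.sum_nonneg fun e _ => hk u v e,
      Finset.mul_sum]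
    refine Finset.sum_congr rfl fun v _ => ?_
    rw [ENNReal.ofReal_sum_of_nonneg fun e _ => hk u v e, Finset.mul_sum, Finset.mul_sum]
    refine Finset.sum_congr rfl fun e _ => ?_
    rw [ENNReal.ofReal_mul (by have := bw_nonneg p u; have := bw_nonneg δ v; have := h e; positivity),
      ENNReal.ofReal_mul (mul_nonneg (bw_nonneg _ _) (bw_nonneg _ _)),
      ENNReal.ofReal_mul (bw_nonneg _ _)]
    simp only [bernoulli_apply, PMF.pure_apply, Fintype.sum_bool, outputs]
    simp [bw, mul_assoc]
    split_ifs <;> simp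
  rw [key, ENNReal.toReal_ofReal]
  refine Finset.sum_nonneg fun u _ => Finset.sum_nonneg fun v _ => Finset.sum_nonneg fun e _ => ?_
  have := bw_nonneg p u
  have := bw_nonneg δ v
  have := h e
  positivity

theorem exampleChannel_P (p δ ε : unitInterval) (y : Bool × (Bool × Bool) × Bool)
    (z : Bool × Unit × Bool) :
    ((exampleChannel p δ ε).P y z).toReal = if z = feedback y then 1 else 0 := by
  by_cases h : z = feedback y
  · rw [if_pos h, h]
    simp [exampleChannel, feedback]
  · rw [if_neg h]
    have : z ≠ (y.1, (), y.2.2) := h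
    simp [exampleChannel, PMF.pure_apply, this]

/-- Encoding functions for the example channel. -/
abbrev ExampleEncoders (M₁ M₂ M₃ N : ℕ) : Type :=
  Encoders (Bool × Bool) Bool (Bool × Bool) Bool Unit Bool M₁ M₂ M₃ N

section Run

variable {M₁ M₂ M₃ N : ℕ}

/-- The outputs `y` satisfy the channel equations for the messages `w` and the noise sequences
`u`, `v`, `e`. -/
def IsRun (f : ExampleEncoders M₁ M₂ M₃ N) (w : Fin M₁ × Fin M₂ × Fin M₃)
    (u v e : Fin N → Bool) (y : Fin N → Bool × (Bool × Bool) × Bool) : Prop :=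
  ∀ n, y n = outputs (f.input w (fun k => feedback (y k)) n) (u n) (v n) (e n)

theorem existsUnique_isRun (f : ExampleEncoders M₁ M₂ M₃ N) (w : Fin M₁ × Fin M₂ × Fin M₃)
    (u v e : Fin N → Bool) : ∃! y, IsRun f w u v e y :=
  existsUnique_causal fun n y => outputs
    (f.f₁ n w.1 (fun k => (y k).1), f.f₂ n w.2.1 (fun _ => ()), f.f₃ n w.2.2 (fun k => (y k).2.2))
    (u n) (v n) (e n)

/-- The outputs of the channel for given messages and noise sequences. -/
noncomputable def run (f : ExampleEncoders M₁ M₂ M₃ N) (w : Fin M₁ × Fin M₂ × Fin M₃)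
    (u v e : Fin N → Bool) : Fin N → Bool × (Bool × Bool) × Bool :=
  (existsUnique_isRun f w u v e).choose

theorem isRun_run (f : ExampleEncoders M₁ M₂ M₃ N) (w : Fin M₁ × Fin M₂ × Fin M₃)
    (u v e : Fin N → Bool) : IsRun f w u v e (run f w u v e) :=
  (existsUnique_isRun f w u v e).choose_spec.1

theorem isRun_iff (f : ExampleEncoders M₁ M₂ M₃ N) (w : Fin M₁ × Fin M₂ × Fin M₃)
    (u v e : Fin N → Bool) (y : Fin N → Bool × (Bool × Bool) × Bool) :
    IsRun f w u v e y ↔ y = run f w u v e :=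
  ⟨fun h => (existsUnique_isRun f w u v e).unique h (isRun_run f w u v e),
    fun h => h ▸ isRun_run f w u v e⟩

/-- The expectation of a function of the three independent noise sequences. -/
noncomputable def noiseE (p δ : ℝ) (F : (Fin N → Bool) → (Fin N → Bool) → (Fin N → Bool) → ℝ) : ℝ :=
  ∑ u, ∑ v, ∑ e, seqW p u * seqW δ v * seqW (1 / 2) e * F u v e

/-- The law of the outputs and of the feedback is the image of the law of the noise sequences. -/
theorem sum_prob (p δ : unitInterval) (f : ExampleEncoders M₁ M₂ M₃ N)
    (w : Fin M₁ × Fin M₂ × Fin M₃) (G : (Fin N → Bool × (Bool × Bool) × Bool) → ℝ) :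
    ∑ y, ∑ z, G y * (exampleChannel p δ 0).prob f w y z =
      noiseE p δ fun u v e => G (run f w u v e) := by
  have h1 : ∀ y : Fin N → Bool × (Bool × Bool) × Bool,
      ∑ z, G y * (exampleChannel p δ 0).prob f w y z =
      ∑ u : Fin N → Bool, ∑ v : Fin N → Bool, ∑ e : Fin N → Bool,
        seqW p u * seqW δ v * seqW (1 / 2) e * if y = run f w u v e then G y else 0 := by
    intro y
    have hz : ∀ z, (exampleChannel p δ 0).prob f w y z =
        if z = (fun k => feedback (y k)) then
          ∏ n, ((exampleChannel p δ 0).Q (f.input w (fun k => feedback (y k)) n) (y n)).toReal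
        else 0 := by
      intro z
      simp only [Channel.prob, exampleChannel_P]
      rw [Finset.prod_mul_distrib, Finset.prod_ite_zero]
      by_cases h : z = fun k => feedback (y k)
      · subst h; simp
      · rw [if_neg h, if_neg, mul_zero]
        intro h'
        exact h (funext fun n => h' n (Finset.mem_univ n))
    simp_rw [hz]
    rw [← Finset.mul_sum, Finset.sum_ite_eq' Finset.univ, if_pos (Finset.mem_univ _)]
    simp only [exampleChannel_Q]
    simp_rw [← sum_prod_apply]
    simp_rw [Finset.mul_sum]
    refine Finset.sum_congr rfl fun u _ => Finset.sum_congr rfl fun v _ =>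
      Finset.sum_congr rfl fun e _ => ?_
    rw [Finset.prod_mul_distrib, Finset.prod_mul_distrib, Finset.prod_mul_distrib,
      Finset.prod_ite_zero]
    have : (∀ i ∈ Finset.univ,
        y i = outputs (f.input w (fun k => feedback (y k)) i) (u i) (v i) (e i)) ↔
        y = run f w u v e := by
      rw [← isRun_iff]
      simp [IsRun]
    simp only [this, Finset.prod_const_one, seqW]
    split_ifs <;> ring
  simp_rw [h1]
  rw [Finset.sum_comm, noiseE]
  refine Finset.sum_congr rfl fun u _ => ?_
  rw [Finset.sum_comm]
  refine Finset.sum_congr rfl fun v _ => ?_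
  rw [Finset.sum_comm]
  refine Finset.sum_congr rfl fun e _ => ?_
  rw [← Finset.mul_sum]
  simp

theorem errorProb_eq (p δ : unitInterval)
    (c : FeedbackBlockCode (Bool × Bool) Bool (Bool × Bool) Bool (Bool × Bool) Bool Bool Unit Bool
      M₁ M₂ M₃ N) :
    (exampleChannel p δ 0).errorProb c =
      ∑ w : Fin M₁ × Fin M₂ × Fin M₃, (1 / ((M₁ : ℝ) * M₂ * M₃)) *
        noiseE p δ fun u v e => if c.dec.decode (run c.enc w u v e) ≠ w then 1 else 0 := by
  simp only [Channel.errorProb]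
  refine Finset.sum_congr rfl fun w _ => ?_
  rw [← sum_prob p δ c.enc w fun y => if c.dec.decode y ≠ w then 1 else 0]
  congr 1
  refine Finset.sum_congr rfl fun y _ => Finset.sum_congr rfl fun z _ => ?_
  split_ifs <;> simp

theorem bw_half_nonneg (b : Bool) : (0 : ℝ) ≤ bw (1 / 2) b := by cases b <;> norm_num [bw]

theorem noiseE_mono (p δ : unitInterval)
    {F G : (Fin N → Bool) → (Fin N → Bool) → (Fin N → Bool) → ℝ} (h : ∀ u v e, F u v e ≤ G u v e) :
    noiseE p δ F ≤ noiseE p δ G := by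
  refine Finset.sum_le_sum fun u _ => Finset.sum_le_sum fun v _ => Finset.sum_le_sum fun e _ =>
    mul_le_mul_of_nonneg_left (h u v e) ?_
  exact mul_nonneg (mul_nonneg (seqW_nonneg _ _) (seqW_nonneg _ _))
    (Finset.prod_nonneg fun _ _ => bw_half_nonneg _)

/-- The third noise sequence integrates out of a function of the first two. -/
theorem noiseE_fst_snd (p δ : ℝ) (F : (Fin N → Bool) → (Fin N → Bool) → ℝ) :
    noiseE p δ (fun u v _ => F u v) = ∑ u, ∑ v, seqW p u * seqW δ v * F u v := by
  refine Finset.sum_congr rfl fun u _ => Finset.sum_congr rfl fun v _ => ?_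
  have : ∀ e : Fin N → Bool, seqW p u * seqW δ v * seqW (1 / 2) e * F u v =
      seqW (1 / 2) e * (seqW p u * seqW δ v * F u v) := fun e => by ring
  simp_rw [this]
  rw [← Finset.sum_mul, sum_seqW, one_mul]

theorem noiseE_fst (p δ : ℝ) (F : (Fin N → Bool) → ℝ) :
    noiseE p δ (fun u _ _ => F u) = ∑ u, seqW p u * F u := by
  rw [noiseE_fst_snd p δ fun u _ => F u]
  refine Finset.sum_congr rfl fun u _ => ?_
  have : ∀ v : Fin N → Bool, seqW p u * seqW δ v * F u = seqW δ v * (seqW p u * F u) :=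
    fun v => by ring
  simp_rw [this]
  rw [← Finset.sum_mul, sum_seqW, one_mul]

end Run

/-! ### The converse -/

theorem sum_bw_mul_log (p : ℝ) : ∑ b, bw p b * Real.log (bw p b) = -Real.binEntropy p := by
  simp only [Fintype.sum_bool, bw, Real.binEntropy_eq_negMulLog_add_negMulLog_one_sub,
    Real.negMulLog]
  simp
  ring

/-- The entropy of an independent Bernoulli sequence. -/
theorem sum_seqW_mul_log {ι : Type*} [Fintype ι] [DecidableEq ι] (p : ℝ) :
    ∑ s : ι → Bool, seqW p s * Real.log (seqW p s) =
      -(Fintype.card ι * Real.binEntropy p) := by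
  have h1 : ∀ s : ι → Bool, seqW p s * Real.log (seqW p s) =
      ∑ i, seqW p s * Real.log (bw p (s i)) := by
    intro s
    by_cases h : ∀ i, bw p (s i) ≠ 0
    · rw [seqW, Real.log_prod fun i _ => h i, Finset.mul_sum]
    · push Not at h
      obtain ⟨i, hi⟩ := h
      have : seqW p s = 0 := Finset.prod_eq_zero (Finset.mem_univ i) hi
      simp [this]
  simp_rw [h1]
  rw [Finset.sum_comm]
  have h2 : ∀ i : ι, ∑ s : ι → Bool, seqW p s * Real.log (bw p (s i)) = -Real.binEntropy p := by
    intro i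
    have h3 := sum_seqW_comp p (fun _ : Unit => i) (fun _ _ _ => rfl)
      fun t => Real.log (bw p (t ()))
    simp only [Function.comp_apply] at h3
    rw [h3, ← sum_bw_mul_log]
    refine Fintype.sum_equiv (Equiv.funUnique Unit Bool) _ _ fun t => ?_
    simp [seqW]
  simp_rw [h2]
  simp

/-- The converse for one receiver: a code with `M` messages for the channel that adds an
independent Bernoulli sequence, where the noise may be recovered from the message and the output
(feedback is allowed). It is the data processing inequality for the relative entropy between the
joint law of message and output and the uniform law, in explicit form. The bound holds for every
`N`, with an error that vanishes with `η` alone. -/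
theorem log_card_le {M N : ℕ} (hM : 0 < M) (p : unitInterval)
    (e : Fin M → (Fin N → Bool) ≃ (Fin N → Bool)) (g : (Fin N → Bool) → Fin M) {η : ℝ}
    (h0 : 0 < η) (h1 : η ≤ 1 / 2)
    (hg : 1 - η ≤ ∑ w, (1 / (M : ℝ)) * ∑ u, seqW p u * if g ((e w).symm u) = w then 1 else 0) :
    (1 - η) * Real.log M + Real.log (1 - η) + η * Real.log η ≤
      N * (Real.log 2 - Real.binEntropy p) := by
  have hM' : (0 : ℝ) < M := by exact_mod_cast hM
  have hM1 : (1 : ℝ) ≤ M := by exact_mod_cast hM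
  set P : Fin M → (Fin N → Bool) → ℝ := fun w y => seqW p (e w y) with hP
  have hPsum : ∀ w, ∑ y, P w y = 1 := fun w => by
    rw [hP, Equiv.sum_comp (e w) (seqW (p : ℝ)), sum_seqW]
  have hPnn : ∀ w y, 0 ≤ P w y := fun w y => seqW_nonneg _ _
  -- the test function of Gibbs' inequality; its mean over uniform messages and outputs is at most `1`,
  -- and the weights `1 - η` and `η` make the loss vanish with `η` even when `N` stays bounded
  set T : Fin M → (Fin N → Bool) → ℝ := fun w y => if g y = w then (1 - η) * M else η with hT
  have hTpos : ∀ w y, 0 < T w y := by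
    intro w y
    simp only [hT]
    split_ifs
    · exact mul_pos (by linarith) hM'
    · exact h0
  -- Gibbs' inequality, pointwise
  have gibbs : ∀ w y, P w y * Real.log (T w y) + (P w y - T w y / 2 ^ N) ≤
      P w y * Real.log (P w y) + P w y * (N * Real.log 2) := by
    intro w y
    rcases (hPnn w y).eq_or_lt with h | h
    · rw [← h]
      have := hTpos w y
      have : 0 ≤ T w y / 2 ^ N := by positivity
      simp only [zero_mul, zero_sub, zero_add]
      linarith
    · have hx : 0 < T w y / 2 ^ N / P w y := div_pos (div_pos (hTpos w y) (by positivity)) h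
      have hl := Real.log_le_sub_one_of_pos hx
      rw [Real.log_div (by have := hTpos w y; positivity) h.ne',
        Real.log_div (hTpos w y).ne' (by positivity), Real.log_pow] at hl
      have := mul_le_mul_of_nonneg_left hl h.le
      have e1 : P w y * (T w y / 2 ^ N / P w y - 1) = T w y / 2 ^ N - P w y := by
        field_simp
      rw [e1] at this
      linarith
  have hsum := Finset.sum_le_sum fun w (_ : w ∈ Finset.univ) =>
    Finset.sum_le_sum fun y (_ : y ∈ (Finset.univ : Finset (Fin N → Bool))) => gibbs w y
  simp only [Finset.sum_add_distrib, Finset.sum_sub_distrib, ← Finset.sum_mul, hPsum] at hsum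
  have hent : ∀ w, ∑ y, P w y * Real.log (P w y) = -(N * Real.binEntropy p) := fun w => by
    rw [hP, Equiv.sum_comp (e w) fun u => seqW (p : ℝ) u * Real.log (seqW (p : ℝ) u),
      sum_seqW_mul_log, Fintype.card_fin]
  have hTsum : ∑ w, ∑ y, T w y / 2 ^ N ≤ M := by
    rw [Finset.sum_comm]
    have : ∀ y : Fin N → Bool, ∑ w, T w y / 2 ^ N ≤ M / 2 ^ N := by
      intro y
      rw [← Finset.sum_div]
      gcongr
      have : ∀ w, T w y ≤ (if g y = w then (1 - η) * M else 0) + η := by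
        intro w
        simp only [hT]
        split_ifs <;> linarith
      refine (Finset.sum_le_sum fun w _ => this w).trans ?_
      rw [Finset.sum_add_distrib]
      simp
      linarith
    refine (Finset.sum_le_sum fun y _ => this y).trans ?_
    simp
    field_simp
    exact le_rfl
  have hlogT : ∀ w, ∑ y, P w y * Real.log (T w y) =
      (∑ u, seqW p u * if g ((e w).symm u) = w then 1 else 0) * (Real.log ((1 - η) * M) -
        Real.log η) + Real.log η := by
    intro w
    rw [← Equiv.sum_comp (e w) fun u => seqW (p : ℝ) u * if g ((e w).symm u) = w then (1 : ℝ) else 0]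
    have : ∀ y, P w y * Real.log (T w y) =
        (seqW p (e w y) * if g ((e w).symm (e w y)) = w then 1 else 0) *
          (Real.log ((1 - η) * M) - Real.log η) + P w y * Real.log η := by
      intro y
      simp only [hT, hP, Equiv.symm_apply_apply]
      split_ifs <;> ring
    simp_rw [this]
    rw [Finset.sum_add_distrib, ← Finset.sum_mul, ← Finset.sum_mul, hPsum, one_mul]
  simp only [hent, hlogT, Finset.sum_add_distrib, ← Finset.sum_mul, Finset.sum_const,
    Finset.card_univ, Fintype.card_fin, nsmul_eq_mul] at hsum
  rw [← Finset.mul_sum, div_mul_eq_mul_div, one_mul, le_div_iff₀ hM'] at hg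
  set S := ∑ w, ∑ u, seqW (p : ℝ) u * if g ((e w).symm u) = w then (1 : ℝ) else 0
  rw [Real.log_mul (by linarith) hM'.ne'] at hsum
  have hη : Real.log η ≤ 0 := Real.log_nonpos h0.le (by linarith)
  have hη' : Real.log (1 - η) ≤ 0 := Real.log_nonpos (by linarith) (by linarith)
  have hlM : 0 ≤ Real.log M := Real.log_nonneg hM1
  have hle : Real.log η ≤ Real.log (1 - η) := Real.log_le_log h0 (by linarith)
  have hc := mul_le_mul_of_nonneg_right hg
    (by linarith : 0 ≤ Real.log (1 - η) + Real.log M - Real.log η)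
  refine le_of_mul_le_mul_left ?_ hM'
  nlinarith [mul_nonneg hM'.le (mul_nonneg h0.le (neg_nonneg.2 hη'))]

section Converse

variable {M₁ M₂ M₃ N : ℕ}

/-- The bijection from the outputs to the noise sequences of an additive channel with feedback, for
the inputs `x` of a fixed message. -/
noncomputable def noiseEquiv (x : (n : Fin N) → (Fin (n : ℕ) → Bool) → Bool) :
    (Fin N → Bool) ≃ (Fin N → Bool) :=
  Equiv.ofBijective (fun y n => xor (y n) (x n (past y n))) <| by
    rw [← Finite.injective_iff_bijective]
    intro y y' h
    refine (existsUnique_causal fun n z => xor (xor (y n) (x n (past y n))) (x n z)).unique ?_ ?_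
    · intro n; simp
    · intro n
      rw [show xor (y n) (x n (past y n)) = xor (y' n) (x n (past y' n)) from congrFun h n]
      simp

theorem noiseEquiv_symm_eq (x : (n : Fin N) → (Fin (n : ℕ) → Bool) → Bool) (y u : Fin N → Bool)
    (h : ∀ n, y n = xor (x n (past y n)) (u n)) : (noiseEquiv x).symm u = y := by
  rw [Equiv.symm_apply_eq]
  funext n
  simp only [noiseEquiv, Equiv.ofBijective_apply]
  rw [h n]
  cases x n (past y n) <;> simp

theorem noiseE_one_sub (p δ : ℝ)
    (F : (Fin N → Bool) → (Fin N → Bool) → (Fin N → Bool) → ℝ) :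
    noiseE p δ (fun u v e => 1 - F u v e) = 1 - noiseE p δ F := by
  have h : noiseE p δ (fun _ _ _ : Fin N → Bool => (1 : ℝ)) = 1 := by
    rw [noiseE_fst p δ fun _ => 1]
    simp [sum_seqW]
  conv_rhs => rw [← h]
  simp only [noiseE, mul_sub, Finset.sum_sub_distrib]

theorem avg_const (hM₁ : 0 < M₁) (hM₂ : 0 < M₂) (hM₃ : 0 < M₃) :
    ∑ _w : Fin M₁ × Fin M₂ × Fin M₃, (1 / ((M₁ : ℝ) * M₂ * M₃)) = 1 := by
  have : (M₁ : ℝ) ≠ 0 := by positivity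
  have : (M₂ : ℝ) ≠ 0 := by positivity
  have : (M₃ : ℝ) ≠ 0 := by positivity
  simp
  field_simp

theorem avg_fst (hM₂ : 0 < M₂) (hM₃ : 0 < M₃) (F : Fin M₁ → ℝ) :
    ∑ w : Fin M₁ × Fin M₂ × Fin M₃, (1 / ((M₁ : ℝ) * M₂ * M₃)) * F w.1 =
      ∑ w, (1 / (M₁ : ℝ)) * F w := by
  have : (M₂ : ℝ) ≠ 0 := by positivity
  have : (M₃ : ℝ) ≠ 0 := by positivity
  rw [Fintype.sum_prod_type]
  refine Finset.sum_congr rfl fun w _ => ?_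
  simp
  field_simp

theorem avg_thd (hM₁ : 0 < M₁) (hM₂ : 0 < M₂) (F : Fin M₃ → ℝ) :
    ∑ w : Fin M₁ × Fin M₂ × Fin M₃, (1 / ((M₁ : ℝ) * M₂ * M₃)) * F w.2.2 =
      ∑ w, (1 / (M₃ : ℝ)) * F w := by
  have : (M₁ : ℝ) ≠ 0 := by positivity
  have : (M₂ : ℝ) ≠ 0 := by positivity
  rw [Fintype.sum_prod_type]
  simp only [Fintype.sum_prod_type, Finset.sum_const, Finset.card_univ, Fintype.card_fin,
    nsmul_eq_mul, ← Finset.mul_sum]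
  field_simp

/-- A lower bound for the mean of a function that is at least `1` where the decoding is correct. -/
theorem one_sub_errorProb_le (p δ : unitInterval) (hM₁ : 0 < M₁) (hM₂ : 0 < M₂) (hM₃ : 0 < M₃)
    (c : FeedbackBlockCode (Bool × Bool) Bool (Bool × Bool) Bool (Bool × Bool) Bool Bool Unit Bool
      M₁ M₂ M₃ N)
    (G : Fin M₁ × Fin M₂ × Fin M₃ → (Fin N → Bool) → (Fin N → Bool) → (Fin N → Bool) → ℝ)
    (hG : ∀ w u v e, 0 ≤ G w u v e)
    (h : ∀ w u v e, c.dec.decode (run c.enc w u v e) = w → 1 ≤ G w u v e) :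
    1 - (exampleChannel p δ 0).errorProb c ≤
      ∑ w, (1 / ((M₁ : ℝ) * M₂ * M₃)) * noiseE p δ (G w) := by
  rw [errorProb_eq]
  conv_lhs => enter [1]; rw [← avg_const hM₁ hM₂ hM₃]
  rw [← Finset.sum_sub_distrib]
  refine Finset.sum_le_sum fun w _ => ?_
  rw [← mul_one_sub, ← noiseE_one_sub]
  refine mul_le_mul_of_nonneg_left (noiseE_mono p δ fun u v e => ?_) (by positivity)
  by_cases hd : c.dec.decode (run c.enc w u v e) = w
  · simpa [hd] using h w u v e hd
  · simpa [hd] using hG w u v e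

/-- The converse for receiver `1`, whose output depends only on its message and on `N_p`. -/
theorem converse_fst (p δ : unitInterval) (hM₁ : 0 < M₁) (hM₂ : 0 < M₂) (hM₃ : 0 < M₃)
    (c : FeedbackBlockCode (Bool × Bool) Bool (Bool × Bool) Bool (Bool × Bool) Bool Bool Unit Bool
      M₁ M₂ M₃ N) {η : ℝ} (h0 : 0 < η) (h1 : η ≤ 1 / 2)
    (hc : (exampleChannel p δ 0).errorProb c ≤ η) :
    (1 - η) * Real.log M₁ + Real.log (1 - η) + η * Real.log η ≤
      N * (Real.log 2 - Real.binEntropy p) := by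
  refine log_card_le hM₁ p (fun w => noiseEquiv fun n z => (c.enc.f₁ n w z).1) c.dec.g₁ h0 h1 ?_
  refine (sub_le_sub_left hc 1).trans ((one_sub_errorProb_le p δ hM₁ hM₂ hM₃ c
    (fun w u _ _ => if c.dec.g₁ ((noiseEquiv fun n z => (c.enc.f₁ n w.1 z).1).symm u) = w.1
      then 1 else 0) (fun w u _ _ => by positivity) fun w u v e hd => ?_).trans ?_)
  · rw [noiseEquiv_symm_eq _ (fun k => (run c.enc w u v e k).1) u
      fun n => congrArg (fun y => y.1) (isRun_run c.enc w u v e n)]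
    have hd' : (c.dec.g₁ fun k => (run c.enc w u v e k).1) = w.1 := congrArg (fun w => w.1) hd
    rw [if_pos hd']
  · simp_rw [noiseE_fst]
    rw [avg_fst hM₂ hM₃ fun w => ∑ u, seqW p u *
      if c.dec.g₁ ((noiseEquiv fun n z => (c.enc.f₁ n w z).1).symm u) = w then 1 else 0]

/-- The converse for receiver `3`, whose output depends only on its message and on `N_p`. -/
theorem converse_thd (p δ : unitInterval) (hM₁ : 0 < M₁) (hM₂ : 0 < M₂) (hM₃ : 0 < M₃)
    (c : FeedbackBlockCode (Bool × Bool) Bool (Bool × Bool) Bool (Bool × Bool) Bool Bool Unit Bool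
      M₁ M₂ M₃ N) {η : ℝ} (h0 : 0 < η) (h1 : η ≤ 1 / 2)
    (hc : (exampleChannel p δ 0).errorProb c ≤ η) :
    (1 - η) * Real.log M₃ + Real.log (1 - η) + η * Real.log η ≤
      N * (Real.log 2 - Real.binEntropy p) := by
  refine log_card_le hM₃ p (fun w => noiseEquiv fun n z => (c.enc.f₃ n w z).2) c.dec.g₃ h0 h1 ?_
  refine (sub_le_sub_left hc 1).trans ((one_sub_errorProb_le p δ hM₁ hM₂ hM₃ c
    (fun w u _ _ => if c.dec.g₃ ((noiseEquiv fun n z => (c.enc.f₃ n w.2.2 z).2).symm u) = w.2.2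
      then 1 else 0) (fun w u _ _ => by positivity) fun w u v e hd => ?_).trans ?_)
  · rw [noiseEquiv_symm_eq _ (fun k => (run c.enc w u v e k).2.2) u
      fun n => congrArg (fun y => y.2.2) (isRun_run c.enc w u v e n)]
    have hd' : (c.dec.g₃ fun k => (run c.enc w u v e k).2.2) = w.2.2 :=
      congrArg (fun w => w.2.2) hd
    rw [if_pos hd']
  · simp_rw [noiseE_fst]
    rw [avg_thd hM₁ hM₂ fun w => ∑ u, seqW p u *
      if c.dec.g₃ ((noiseEquiv fun n z => (c.enc.f₃ n w z).2).symm u) = w then 1 else 0]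

/-- For given other messages and noise, the messages of transmitter `2` that are decoded correctly
have different input sequences, since without feedback these are functions of the message. -/
theorem converse_snd (p δ : unitInterval) (hM₁ : 0 < M₁) (hM₂ : 0 < M₂) (hM₃ : 0 < M₃)
    (c : FeedbackBlockCode (Bool × Bool) Bool (Bool × Bool) Bool (Bool × Bool) Bool Bool Unit Bool
      M₁ M₂ M₃ N) {η : ℝ} (hc : (exampleChannel p δ 0).errorProb c ≤ η) :
    (1 - η) * M₂ ≤ 2 ^ N := by
  classical
  have hM₁' : (0 : ℝ) < M₁ := by exact_mod_cast hM₁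
  have hM₂' : (0 : ℝ) < M₂ := by exact_mod_cast hM₂
  have hM₃' : (0 : ℝ) < M₃ := by exact_mod_cast hM₃
  set G : Fin M₁ × Fin M₂ × Fin M₃ → (Fin N → Bool) → (Fin N → Bool) → (Fin N → Bool) → ℝ :=
    fun w u v e => if c.dec.decode (run c.enc w u v e) = w then 1 else 0 with hG
  have h1 := (sub_le_sub_left hc 1).trans (one_sub_errorProb_le p δ hM₁ hM₂ hM₃ c G
    (fun w u v e => by simp only [hG]; positivity) fun w u v e hd => by simp only [hG, if_pos hd, le_refl])
  have count : ∀ w₁ w₃ u v e, ∑ w₂, G (w₁, w₂, w₃) u v e ≤ 2 ^ N := by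
    intro w₁ w₃ u v e
    simp only [hG, Finset.sum_boole]
    have : (Finset.univ.filter fun w₂ : Fin M₂ =>
        c.dec.decode (run c.enc (w₁, w₂, w₃) u v e) = (w₁, w₂, w₃)).card ≤
        (Finset.univ : Finset (Fin N → Bool)).card := by
      refine Finset.card_le_card_of_injOn (fun w₂ n => c.enc.f₂ n w₂ fun _ => ())
        (fun _ _ => Finset.mem_coe.2 (Finset.mem_univ _)) ?_
      intro a ha b hb hab
      have ha' := (Finset.mem_filter.1 ha).2
      have hb' := (Finset.mem_filter.1 hb).2
      have hr : run c.enc (w₁, a, w₃) u v e = run c.enc (w₁, b, w₃) u v e := by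
        rw [← isRun_iff]
        intro n
        rw [isRun_run c.enc (w₁, a, w₃) u v e n]
        congr 1
        simp only [Encoders.input, Prod.mk.injEq, true_and, and_true]
        exact congrFun hab n
      rw [hr, hb'] at ha'
      exact (congrArg (fun w => w.2.1) ha').symm
    calc ((Finset.univ.filter fun w₂ : Fin M₂ =>
        c.dec.decode (run c.enc (w₁, w₂, w₃) u v e) = (w₁, w₂, w₃)).card : ℝ) ≤
        ((Finset.univ : Finset (Fin N → Bool)).card : ℝ) := by exact_mod_cast this
      _ = 2 ^ N := by simp
  have h2 : ∀ w₁ w₃, ∑ w₂, noiseE p δ (G (w₁, w₂, w₃)) ≤ 2 ^ N := by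
    intro w₁ w₃
    have e1 : ∑ w₂, noiseE p δ (G (w₁, w₂, w₃)) =
        noiseE p δ fun u v e => ∑ w₂, G (w₁, w₂, w₃) u v e := by
      simp only [noiseE, Finset.mul_sum]
      rw [Finset.sum_comm]
      refine Finset.sum_congr rfl fun u _ => ?_
      rw [Finset.sum_comm]
      refine Finset.sum_congr rfl fun v _ => ?_
      rw [Finset.sum_comm]
    rw [e1]
    refine (noiseE_mono p δ fun u v e => count w₁ w₃ u v e).trans ?_
    rw [noiseE_fst p δ fun _ => 2 ^ N, ← Finset.sum_mul, sum_seqW, one_mul]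
  rw [← Finset.mul_sum, Fintype.sum_prod_type] at h1
  have h3 : ∑ w₁, ∑ w : Fin M₂ × Fin M₃, noiseE p δ (G (w₁, w)) ≤ M₁ * M₃ * 2 ^ N := by
    simp_rw [Fintype.sum_prod_type_right]
    refine (Finset.sum_le_sum fun w₁ _ => Finset.sum_le_sum fun w₃ _ => h2 w₁ w₃).trans ?_
    simp
    linarith
  rw [one_div_mul_eq_div, le_div_iff₀ (by positivity)] at h1
  have : M₁ * M₃ * ((1 - η) * M₂) ≤ M₁ * M₃ * (2 : ℝ) ^ N := by linarith
  exact le_of_mul_le_mul_left this (by positivity)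

end Converse

/-- A code exists whenever a rate triple is achievable: a randomized strategy is supported on
encoding functions that can be completed to such a code. -/
theorem exists_code_of_epsAchievable {p δ : unitInterval} {ε : ℝ} {R : ℝ × ℝ × ℝ}
    (h : (exampleChannel p δ 0).EpsAchievable ε R) :
    ∃ M₁ M₂ M₃ N : ℕ, 0 < M₁ ∧ 0 < M₂ ∧ 0 < M₃ ∧ 0 < N ∧
      ∃ c : FeedbackBlockCode (Bool × Bool) Bool (Bool × Bool) Bool (Bool × Bool) Bool Bool Unit
        Bool M₁ M₂ M₃ N, (exampleChannel p δ 0).AchievableByCode c ε R := by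
  obtain ⟨M₁, M₂, M₃, N, h1, h2, h3, h4, hc | ⟨S, hS⟩⟩ := h
  · exact ⟨M₁, M₂, M₃, N, h1, h2, h3, h4, hc⟩
  · refine ⟨M₁, M₂, M₃, N, h1, h2, h3, h4, ?_⟩
    by_contra hne
    push Not at hne
    have : {f | ∃ g : Decoders Bool (Bool × Bool) Bool M₁ M₂ M₃ N,
        (exampleChannel p δ 0).AchievableByCode ⟨f, g⟩ ε R} = ∅ := by
      ext f
      simp only [Set.mem_ofPred_eq, Set.mem_empty_iff_false, iff_false, not_exists]
      exact fun g => hne ⟨f, g⟩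
    rw [Channel.AchievableByStrategy, this] at hS
    simp at hS

theorem hb_mul_log (p : ℝ) : hb p * Real.log 2 = Real.binEntropy p := by
  rw [hb, div_mul_cancel₀ _ (Real.log_pos one_lt_two).ne']

theorem rate_le_of_log_card_le {M N : ℕ} (hN : 0 < N) {r H η : ℝ} (h0 : 0 < η) (h1 : η ≤ 1 / 2)
    (hr : r - η ≤ 1 / (N : ℝ) * Real.logb 2 M)
    (h : (1 - η) * Real.log M + Real.log (1 - η) + η * Real.log η ≤
      N * (Real.log 2 - H)) :
    (1 - η) * (r - η) * Real.log 2 + Real.log (1 - η) + η * Real.log η ≤ Real.log 2 - H := by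
  have hN' : (1 : ℝ) ≤ N := by exact_mod_cast hN
  have hl := Real.log_pos one_lt_two
  have ha : Real.log (1 - η) ≤ 0 := Real.log_nonpos (by linarith) (by linarith)
  have hb : Real.log η ≤ 0 := Real.log_nonpos h0.le (by linarith)
  have h2 : N * (r - η) * Real.log 2 ≤ Real.log M := by
    rw [Real.logb, div_mul_div_comm, one_mul, le_div_iff₀ (by positivity)] at hr
    linarith
  have h3 := mul_le_mul_of_nonneg_left h2 (by linarith : 0 ≤ 1 - η)
  refine le_of_mul_le_mul_left ?_ (by linarith : (0 : ℝ) < N)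
  nlinarith [mul_nonneg (sub_nonneg.2 hN') (neg_nonneg.2 ha),
    mul_nonneg (sub_nonneg.2 hN') (mul_nonneg h0.le (neg_nonneg.2 hb))]

/-- The limit `η → 0` of the converse bounds. -/
theorem rate_le_of_forall {r H : ℝ} (h : ∀ η : ℝ, 0 < η → η ≤ 1 / 2 →
    (1 - η) * (r - η) * Real.log 2 + Real.log (1 - η) + η * Real.log η ≤ Real.log 2 - H) :
    r * Real.log 2 ≤ Real.log 2 - H := by
  have hcont : Filter.Tendsto
      (fun η : ℝ => (1 - η) * (r - η) * Real.log 2 + Real.log (1 - η) + η * Real.log η)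
      (nhdsWithin 0 (Set.Ioi 0)) (nhds ((1 - 0) * (r - 0) * Real.log 2 + Real.log (1 - 0) +
        0 * Real.log 0)) := by
    refine Filter.Tendsto.mono_left (ContinuousAt.tendsto (x := 0) ?_) nhdsWithin_le_nhds
    refine ContinuousAt.add (ContinuousAt.add (by fun_prop) ?_) Real.continuous_mul_log.continuousAt
    exact ContinuousAt.log (by fun_prop) (by norm_num)
  simp only [sub_zero, one_mul, Real.log_one, zero_mul, add_zero] at hcont
  refine le_of_tendsto hcont ?_
  filter_upwards [Ioc_mem_nhdsGT (by norm_num : (0 : ℝ) < 1 / 2)] with η hη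
  exact h η hη.1 hη.2

theorem feedbackCapacity_subset (p δ : unitInterval) :
    (exampleChannel p δ 0).feedbackCapacity ⊆
      {R : ℝ × ℝ × ℝ | R.1 ≤ 1 - hb p ∧ R.2.1 ≤ 1 ∧ R.2.2 ≤ 1 - hb p} := by
  intro R hR
  have hl := Real.log_pos one_lt_two
  have key : ∀ r, r * Real.log 2 ≤ Real.log 2 - Real.binEntropy p → r ≤ 1 - hb p := by
    intro r hr
    rw [← hb_mul_log] at hr
    nlinarith
  refine ⟨key _ (rate_le_of_forall fun η h0 h1 => ?_), ?_,
    key _ (rate_le_of_forall fun η h0 h1 => ?_)⟩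
  · obtain ⟨M₁, M₂, M₃, N, h1', h2', h3', hN, c, hc, hr₁, -, -⟩ := exists_code_of_epsAchievable (hR η h0)
    exact rate_le_of_log_card_le hN h0 h1 hr₁ (converse_fst p δ h1' h2' h3' c h0 h1 hc)
  · have : R.2.1 * Real.log 2 ≤ Real.log 2 - 0 := by
      refine rate_le_of_forall fun η h0 h1 => ?_
      obtain ⟨M₁, M₂, M₃, N, h1', h2', h3', hN, c, hc, -, hr₂, -⟩ := exists_code_of_epsAchievable (hR η h0)
      refine rate_le_of_log_card_le hN h0 h1 hr₂ ?_
      have hM : (1 : ℝ) ≤ M₂ := by exact_mod_cast h2'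
      have h := Real.log_le_log (mul_pos (by linarith) (by linarith))
        (converse_snd p δ h1' h2' h3' c hc)
      rw [Real.log_mul (by linarith) (by linarith), Real.log_pow] at h
      have := mul_nonneg h0.le (Real.log_nonneg hM)
      have := mul_nonneg h0.le (neg_nonneg.2 (Real.log_nonpos h0.le (by linarith : η ≤ 1)))
      linarith
    nlinarith
  · obtain ⟨M₁, M₂, M₃, N, h1', h2', h3', hN, c, hc, -, -, hr₃⟩ := exists_code_of_epsAchievable (hR η h0)
    exact rate_le_of_log_card_le hN h0 h1 hr₃ (converse_thd p δ h1' h2' h3' c h0 h1 hc)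

/-! ### Joint source-channel coding -/

/-- The componentwise sum modulo `2` of two sequences of bits. -/
def xorSeq {ι : Type*} (s t : ι → Bool) : ι → Bool := fun i => xor (s i) (t i)

theorem xorSeq_xorSeq {ι : Type*} (s t : ι → Bool) : xorSeq s (xorSeq s t) = t := by
  funext i
  simp [xorSeq]

/-- The translation of the sequences of bits by `s`. -/
def xorEquiv {ι : Type*} (s : ι → Bool) : (ι → Bool) ≃ (ι → Bool) where
  toFun := xorSeq s
  invFun := xorSeq s
  left_inv := xorSeq_xorSeq s
  right_inv := xorSeq_xorSeq s

/-- The error probability when a Bernoulli source sequence with parameter `p` is encoded by `φ`,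
sent over a binary symmetric channel with crossover probability `δ`, and decoded by `ψ`. -/
noncomputable def transmissionError {a L : ℕ} (p δ : ℝ) (φ : (Fin a → Bool) → Fin L → Bool)
    (ψ : (Fin L → Bool) → Fin a → Bool) : ℝ :=
  ∑ s, ∑ v, seqW p s * seqW δ v * if ψ (xorSeq (φ s) v) ≠ s then 1 else 0

/-- Two values of a uniformly random function at different points are independent, and the first
is uniform. -/
theorem sum_apply_pair {S V : Type*} [Fintype S] [DecidableEq S] [Fintype V] [DecidableEq V]
    {s s' : S} (h : s ≠ s') (G : V → V → ℝ) :
    Fintype.card V * ∑ φ : S → V, G (φ s) (φ s') = ∑ φ : S → V, ∑ c, G c (φ s') := by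
  have e1 : ∀ F : (S → V) → ℝ, ∑ φ : S → V, F φ =
      ∑ q : V × ({j // j ≠ s} → V), F ((Equiv.funSplitAt s V).symm q) :=
    fun F => ((Equiv.funSplitAt s V).symm.sum_comp F).symm
  rw [e1, e1, Fintype.sum_prod_type, Fintype.sum_prod_type]
  have h1 : ∀ c r, (Equiv.funSplitAt s V).symm (c, r) s = c := by
    intro c r; simp [Equiv.funSplitAt]
  have h2 : ∀ c r, (Equiv.funSplitAt s V).symm (c, r) s' = r ⟨s', h.symm⟩ := by
    intro c r; simp [Equiv.funSplitAt, h.symm]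
  simp only [h1, h2]
  rw [Finset.sum_const, Finset.card_univ, nsmul_eq_mul]
  congr 1
  rw [Finset.sum_comm]

/-- Random coding: the average over all encoders of the error probability of the decoder that
looks for a source sequence that is plausible (together with the corresponding noise). -/
theorem exists_code_of_threshold {a L : ℕ} (p δ : unitInterval) {τ : ℝ} (hτ : 0 < τ) :
    ∃ φ ψ, transmissionError (a := a) (L := L) p δ φ ψ ≤
      (∑ s : Fin a → Bool, ∑ v : Fin L → Bool, seqW p s * seqW δ v *
        if τ * (seqW p s * seqW δ v) < 1 then 1 else 0) + τ / 2 ^ L := by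
  classical
  set good : (Fin a → Bool) → (Fin L → Bool) → Prop :=
    fun s v => 1 ≤ τ * (seqW p s * seqW δ v) with hgood
  set B := ∑ s : Fin a → Bool, ∑ v : Fin L → Bool, seqW p s * seqW δ v *
        if τ * (seqW p s * seqW δ v) < 1 then (1 : ℝ) else 0 with hB
  have hw : ∀ (s : Fin a → Bool) (v : Fin L → Bool), 0 ≤ seqW (p : ℝ) s * seqW (δ : ℝ) v :=
    fun s v => mul_nonneg (seqW_nonneg _ _) (seqW_nonneg _ _)
  set conf : ((Fin a → Bool) → Fin L → Bool) → ℝ := fun φ => ∑ s, ∑ v, seqW p s * seqW δ v *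
    ∑ s', if s ≠ s' ∧ good s' (xorSeq (φ s') (xorSeq (φ s) v)) then 1 else 0 with hconf
  -- a decoder that picks a plausible source sequence errs only for an implausible pair or if
  -- another source sequence is plausible
  have step1 : ∀ φ, ∃ ψ, transmissionError (a := a) (L := L) p δ φ ψ ≤ B + conf φ := by
    intro φ
    refine ⟨fun y => if h : ∃ s, good s (xorSeq (φ s) y) then h.choose else fun _ => false, ?_⟩
    rw [hB, hconf, transmissionError, ← Finset.sum_add_distrib]
    refine Finset.sum_le_sum fun s _ => ?_
    rw [← Finset.sum_add_distrib]
    refine Finset.sum_le_sum fun v _ => ?_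
    rw [← mul_add]
    refine mul_le_mul_of_nonneg_left ?_ (hw s v)
    have hnn : (0 : ℝ) ≤ ∑ s', if s ≠ s' ∧ good s' (xorSeq (φ s') (xorSeq (φ s) v))
        then 1 else 0 := Finset.sum_nonneg fun _ _ => by positivity
    by_cases hg : good s v
    · have hex : ∃ s', good s' (xorSeq (φ s') (xorSeq (φ s) v)) :=
        ⟨s, by rwa [xorSeq_xorSeq]⟩
      rw [dif_pos hex]
      by_cases hs : hex.choose = s
      · rw [if_neg (not_not.2 hs)]
        exact add_nonneg (by positivity) hnn
      · rw [if_pos hs]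
        refine le_add_of_nonneg_of_le (by positivity) ?_
        refine le_trans ?_ (Finset.single_le_sum (fun _ _ => by positivity)
          (Finset.mem_univ hex.choose))
        rw [if_pos ⟨Ne.symm hs, hex.choose_spec⟩]
    · rw [if_pos (show τ * (seqW (p : ℝ) s * seqW (δ : ℝ) v) < 1 from not_le.1 hg)]
      split_ifs <;> linarith
  -- there are at most `τ` plausible pairs
  have card_good : ∑ s, ∑ v, (if good s v then (1 : ℝ) else 0) ≤ τ := by
    have : ∀ s v, (if good s v then (1 : ℝ) else 0) ≤ τ * (seqW p s * seqW δ v) := by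
      intro s v
      split_ifs with h
      · exact h
      · exact mul_nonneg hτ.le (hw s v)
    refine (Finset.sum_le_sum fun s _ => Finset.sum_le_sum fun v _ => this s v).trans ?_
    simp_rw [← Finset.mul_sum, sum_seqW, mul_one, sum_seqW, mul_one]
    exact le_rfl
  have step2 : ∑ φ, conf φ ≤ ∑ _φ : (Fin a → Bool) → Fin L → Bool, τ / 2 ^ L := by
    have pair : ∀ s s' v, ∑ φ : (Fin a → Bool) → Fin L → Bool,
        (if s ≠ s' ∧ good s' (xorSeq (φ s') (xorSeq (φ s) v)) then (1 : ℝ) else 0) ≤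
        ∑ _φ : (Fin a → Bool) → Fin L → Bool, (∑ c, if good s' c then (1 : ℝ) else 0) / 2 ^ L := by
      intro s s' v
      by_cases h : s = s'
      · simp only [h, ne_eq, not_true_eq_false, false_and, if_false, Finset.sum_const_zero]
        exact Finset.sum_nonneg fun _ _ => by positivity
      · have h1 := sum_apply_pair h fun c d : Fin L → Bool =>
          if good s' (xorSeq d (xorSeq c v)) then (1 : ℝ) else 0
        have h2 : ∀ d : Fin L → Bool, ∑ c : Fin L → Bool,
            (if good s' (xorSeq d (xorSeq c v)) then (1 : ℝ) else 0) =
            ∑ c, if good s' c then (1 : ℝ) else 0 := by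
          intro d
          refine Fintype.sum_equiv ((xorEquiv v).trans (xorEquiv d)) _ _ fun c => ?_
          have : xorSeq c v = xorSeq v c := by funext i; simp [xorSeq, Bool.xor_comm]
          rw [this]
          rfl
        simp only [h2] at h1
        simp only [ne_eq, h, not_false_eq_true, true_and]
        rw [← Finset.sum_div, le_div_iff₀ (by positivity), ← h1, mul_comm]
        simp
    have e1 : ∑ φ, conf φ = ∑ s, ∑ v, seqW p s * seqW δ v * ∑ s',
        ∑ φ : (Fin a → Bool) → Fin L → Bool,
          if s ≠ s' ∧ good s' (xorSeq (φ s') (xorSeq (φ s) v)) then (1 : ℝ) else 0 := by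
      rw [hconf, Finset.sum_comm]
      refine Finset.sum_congr rfl fun s _ => ?_
      rw [Finset.sum_comm]
      refine Finset.sum_congr rfl fun v _ => ?_
      rw [← Finset.mul_sum, Finset.sum_comm]
    rw [e1]
    have e2 : ∀ s v, seqW (p : ℝ) s * seqW (δ : ℝ) v * ∑ s',
        ∑ φ : (Fin a → Bool) → Fin L → Bool,
          (if s ≠ s' ∧ good s' (xorSeq (φ s') (xorSeq (φ s) v)) then (1 : ℝ) else 0) ≤
        seqW (p : ℝ) s * seqW (δ : ℝ) v *
          ∑ _φ : (Fin a → Bool) → Fin L → Bool, τ / 2 ^ L := by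
      intro s v
      refine mul_le_mul_of_nonneg_left ?_ (hw s v)
      refine (Finset.sum_le_sum fun s' _ => pair s s' v).trans ?_
      rw [Finset.sum_comm]
      refine Finset.sum_le_sum fun φ _ => ?_
      rw [← Finset.sum_div]
      gcongr
    refine (Finset.sum_le_sum fun s _ => Finset.sum_le_sum fun v _ => e2 s v).trans ?_
    simp_rw [← Finset.sum_mul, ← Finset.mul_sum, sum_seqW, mul_one, sum_seqW, one_mul]
    exact le_rfl
  obtain ⟨φ, -, hφ⟩ := Finset.exists_le_of_sum_le Finset.univ_nonempty step2
  obtain ⟨ψ, hψ⟩ := step1 φ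
  exact ⟨φ, ψ, hψ.trans (by linarith)⟩

/-- The exponential moment of the information density of a Bernoulli variable. -/
noncomputable def tilt (p t : ℝ) : ℝ := ∑ b, bw p b ^ (1 - t)

theorem seqW_rpow {ι : Type*} [Fintype ι] (p : unitInterval) (s : ι → Bool) (r : ℝ) :
    seqW (p : ℝ) s ^ r = ∏ i, bw (p : ℝ) (s i) ^ r := by
  rw [seqW, Real.finsetProd_rpow _ _ fun _ _ => bw_nonneg _ _]

theorem sum_seqW_rpow {a : ℕ} (p : unitInterval) (t : ℝ) :
    ∑ s : Fin a → Bool, seqW (p : ℝ) s ^ (1 - t) = tilt p t ^ a := by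
  simp_rw [seqW_rpow]
  rw [sum_prod_apply fun _ b => bw (p : ℝ) b ^ (1 - t)]
  simp [tilt]

/-- The probability of an implausible pair of source and noise sequences. -/
theorem chernoff {a L : ℕ} (p δ : unitInterval) {τ t : ℝ} (hτ : 0 < τ) (h0 : 0 ≤ t) (h1 : t < 1) :
    (∑ s : Fin a → Bool, ∑ v : Fin L → Bool, seqW p s * seqW δ v *
        if τ * (seqW p s * seqW δ v) < 1 then (1 : ℝ) else 0) ≤
      τ ^ (-t) * (tilt p t ^ a * tilt δ t ^ L) := by
  have h : ∀ (s : Fin a → Bool) (v : Fin L → Bool), (seqW p s * seqW δ v *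
      if τ * (seqW p s * seqW δ v) < 1 then (1 : ℝ) else 0) ≤
      τ ^ (-t) * (seqW (p : ℝ) s ^ (1 - t) * seqW (δ : ℝ) v ^ (1 - t)) := by
    intro s v
    have hp := seqW_nonneg p s
    have hd := seqW_nonneg δ v
    split_ifs with hlt
    · rw [mul_one, ← Real.mul_rpow hp hd]
      have hx : 0 ≤ τ * (seqW (p : ℝ) s * seqW (δ : ℝ) v) := by positivity
      have := Real.rpow_le_rpow_of_exponent_ge' hx hlt.le (by linarith) (by linarith : 1 - t ≤ 1)
      rw [Real.rpow_one, Real.mul_rpow hτ.le (by positivity), show 1 - t = -t + 1 by ring,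
        Real.rpow_add hτ, Real.rpow_one, mul_comm (τ ^ (-t)) τ, mul_assoc] at this
      rw [show 1 - t = -t + 1 by ring]
      exact le_of_mul_le_mul_left this hτ
    · rw [mul_zero]
      positivity
  refine (Finset.sum_le_sum fun s _ => Finset.sum_le_sum fun v _ => h s v).trans ?_
  simp_rw [← Finset.mul_sum, ← Finset.sum_mul, sum_seqW_rpow]
  exact le_rfl

theorem hasDerivAt_rpow_one_sub {x : ℝ} (hx : 0 ≤ x) :
    HasDerivAt (fun t : ℝ => x ^ (1 - t)) (Real.negMulLog x) 0 := by
  rcases hx.eq_or_lt with rfl | hx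
  · rw [Real.negMulLog_zero]
    refine (hasDerivAt_const (0 : ℝ) (0 : ℝ)).congr_of_eventuallyEq ?_
    filter_upwards [Iio_mem_nhds (by norm_num : (0 : ℝ) < 1)] with t ht
    exact Real.zero_rpow (by simp only [Set.mem_Iio] at ht; linarith)
  · have h := ((hasDerivAt_id (0 : ℝ)).const_sub 1).const_rpow hx
    refine h.congr_deriv ?_
    simp [Real.negMulLog]
    ring

/-- The derivative of `tilt p` at `0` is the entropy. -/
theorem eventually_tilt_le (p : unitInterval) {γ : ℝ} (hγ : 0 < γ) :
    ∀ᶠ t in nhdsWithin (0 : ℝ) (Set.Ioi 0),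
      tilt p t ≤ Real.exp (t * (Real.binEntropy p + γ)) := by
  have h0 : tilt p 0 = 1 := by simp [tilt, bw]
  have hd : HasDerivAt (tilt p) (Real.binEntropy p) 0 := by
    have := (hasDerivAt_rpow_one_sub (bw_nonneg p true)).add
      (hasDerivAt_rpow_one_sub (bw_nonneg p false))
    simp only [bw, if_true, Bool.false_eq_true, if_false] at this
    rw [← Real.binEntropy_eq_negMulLog_add_negMulLog_one_sub] at this
    refine this.congr_of_eventuallyEq (Filter.Eventually.of_forall fun t => ?_)
    simp [tilt, bw]
  have hs := hasDerivAt_iff_tendsto_slope_zero.1 hd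
  have hs' := hs.mono_left (nhdsWithin_mono (0 : ℝ) fun t (ht : 0 < t) => ht.ne')
  filter_upwards [hs'.eventually (gt_mem_nhds (by linarith : Real.binEntropy p <
    Real.binEntropy p + γ)), self_mem_nhdsWithin] with t ht htp
  have htp : 0 < t := htp
  rw [zero_add, h0, smul_eq_mul, inv_mul_lt_iff₀ htp] at ht
  have := Real.add_one_le_exp (t * (Real.binEntropy p + γ))
  linarith

theorem tilt_nonneg (p : unitInterval) (t : ℝ) : 0 ≤ tilt p t :=
  Finset.sum_nonneg fun _ _ => Real.rpow_nonneg (bw_nonneg _ _) _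

/-- Joint source-channel coding: `a` source bits can be sent over `L` channel uses if the entropy of
source and noise stays below `L * log 2` by a linear gap. -/
theorem exists_transmissionError_le (p δ : unitInterval) {γ η : ℝ} (hγ : 0 < γ) (hη : 0 < η) :
    ∃ L₀ : ℕ, ∀ L ≥ L₀, ∀ a ≤ L,
      a * Real.binEntropy p + L * Real.binEntropy δ + L * γ ≤ L * Real.log 2 →
      ∃ φ ψ, transmissionError (a := a) (L := L) p δ φ ψ ≤ η := by
  obtain ⟨t, ⟨ht1, ht2⟩, ht3⟩ := ((eventually_tilt_le p (by positivity : 0 < γ / 4)).and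
    (eventually_tilt_le δ (by positivity : 0 < γ / 4))).and
      (Ioo_mem_nhdsGT (by norm_num : (0 : ℝ) < 1)) |>.exists
  obtain ⟨ht0, ht1'⟩ := ht3
  have htend : ∀ c : ℝ, 0 < c →
      Filter.Tendsto (fun L : ℕ => Real.exp (-(L * c))) Filter.atTop (nhds 0) := fun c hc =>
    Real.tendsto_exp_neg_atTop_nhds_zero.comp
      (tendsto_natCast_atTop_atTop.atTop_mul_const hc)
  have hlim := (htend (t * (γ / 4)) (by positivity)).add (htend (γ / 4) (by positivity))
  rw [add_zero] at hlim
  obtain ⟨L₀, hL₀⟩ := Filter.eventually_atTop.1 (hlim.eventually (gt_mem_nhds hη))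
  refine ⟨L₀, fun L hL a ha h => ?_⟩
  -- the number of plausible pairs may exceed the typical one, but not reach `2 ^ L`
  obtain ⟨φ, ψ, hφψ⟩ := exists_code_of_threshold (a := a) (L := L) p δ
    (Real.exp_pos (L * (Real.log 2 - γ / 4)))
  refine ⟨φ, ψ, hφψ.trans (le_trans (add_le_add ?_ ?_) (hL₀ L hL).le)⟩
  · refine (chernoff p δ (Real.exp_pos _) ht0.le ht1').trans ?_
    have h1 := pow_le_pow_left₀ (tilt_nonneg p t) ht1 a
    have h2 := pow_le_pow_left₀ (tilt_nonneg δ t) ht2 L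
    have h3 := mul_le_mul h1 h2 (pow_nonneg (tilt_nonneg _ _) _) (by positivity)
    refine (mul_le_mul_of_nonneg_left h3 (Real.rpow_nonneg (Real.exp_pos _).le _)).trans ?_
    rw [← Real.exp_mul, ← Real.exp_nat_mul, ← Real.exp_nat_mul, ← Real.exp_add, ← Real.exp_add,
      Real.exp_le_exp]
    have ha' : (a : ℝ) ≤ L := by exact_mod_cast ha
    have h4 := mul_le_mul_of_nonneg_left h ht0.le
    have h5 := mul_le_mul_of_nonneg_left ha' (by positivity : 0 ≤ t * (γ / 4))
    linarith
  · rw [show (2 : ℝ) ^ L = Real.exp (L * Real.log 2) by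
      rw [Real.exp_nat_mul, Real.exp_log two_pos], ← Real.exp_sub, Real.exp_le_exp]
    linarith

/-- Channel coding for the binary symmetric channel, with uniformly distributed messages. -/
theorem exists_channel_code (p : unitInterval) {γ η : ℝ} (hγ : 0 < γ) (hη : 0 < η) :
    ∃ L₀ : ℕ, ∀ L ≥ L₀, ∃ a : ℕ,
      L * (Real.log 2 - Real.binEntropy p - γ) ≤ a * Real.log 2 ∧
      ∃ φ ψ, transmissionError (a := a) (L := L) (1 / 2) p φ ψ ≤ η := by
  obtain ⟨L₀, hL₀⟩ := exists_transmissionError_le ⟨1 / 2, by norm_num, by norm_num⟩ p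
    (by positivity : 0 < γ / 2) hη
  obtain ⟨L₁, hL₁⟩ := exists_nat_gt (2 * Real.log 2 / γ)
  have hl := Real.log_pos one_lt_two
  refine ⟨max L₀ L₁, fun L hL => ?_⟩
  have hLγ : Real.log 2 ≤ L * (γ / 2) := by
    have : (L₁ : ℝ) ≤ L := by exact_mod_cast le_of_max_le_right hL
    rw [div_lt_iff₀ hγ] at hL₁
    nlinarith
  rcases le_total (Real.log 2 - Real.binEntropy p - γ / 2) 0 with h | h
  · refine ⟨0, ?_, fun _ _ => false, fun _ => Fin.elim0, ?_⟩
    · rw [Nat.cast_zero, zero_mul]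
      exact mul_nonpos_of_nonneg_of_nonpos (Nat.cast_nonneg _) (by linarith)
    · refine le_trans (le_of_eq ?_) hη.le
      simp [transmissionError, eq_iff_true_of_subsingleton]
  · set x := L * (Real.log 2 - Real.binEntropy p - γ / 2) / Real.log 2 with hx
    have hx0 : 0 ≤ x := by positivity
    have hxl : x * Real.log 2 = L * (Real.log 2 - Real.binEntropy p - γ / 2) :=
      div_mul_cancel₀ _ hl.ne'
    have hfl := Nat.floor_le hx0
    have hfl' := Nat.lt_floor_add_one x
    have h1 := mul_le_mul_of_nonneg_right hfl hl.le
    refine ⟨⌊x⌋₊, ?_, ?_⟩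
    · have h2 := mul_le_mul_of_nonneg_right hfl'.le hl.le
      linarith
    · refine hL₀ L (le_of_max_le_left hL) _ ?_ ?_
      · have : (⌊x⌋₊ : ℝ) ≤ L := by
          refine hfl.trans ?_
          rw [hx, div_le_iff₀ hl]
          have := Real.binEntropy_nonneg p.2.1 p.2.2
          refine mul_le_mul_of_nonneg_left (by linarith) (Nat.cast_nonneg _)
        exact_mod_cast this
      · have : Real.binEntropy ((⟨1 / 2, by norm_num, by norm_num⟩ : unitInterval) : ℝ) =
            Real.log 2 := by
          simp only [one_div]
          exact Real.binEntropy_two_inv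
        rw [this]
        linarith

/-- A source without entropy is deterministic. -/
theorem transmissionError_eq_zero {a L : ℕ} (p δ : unitInterval) (hp : Real.binEntropy p = 0) :
    ∃ φ ψ, transmissionError (a := a) (L := L) p δ φ ψ = 0 := by
  have hb : ∃ b : Bool, ∀ b', b' ≠ b → bw (p : ℝ) b' = 0 := by
    rcases Real.binEntropy_eq_zero.1 hp with h | h
    · exact ⟨false, by simp [bw, h]⟩
    · exact ⟨true, by simp [bw, h]⟩
  obtain ⟨b, hb⟩ := hb
  refine ⟨fun _ _ => false, fun _ _ => b, ?_⟩
  refine Finset.sum_eq_zero fun s _ => Finset.sum_eq_zero fun v _ => ?_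
  split_ifs with h
  · obtain ⟨i, hi⟩ := Function.ne_iff.1 h
    have : seqW (p : ℝ) s = 0 := Finset.prod_eq_zero (Finset.mem_univ i) (hb _ (Ne.symm hi))
    simp [this]
  · simp

/-! ### The block-Markov code -/

section Blocks

variable {B L a : ℕ}

/-- The position `j` of the block `b`, among `B + 1` blocks of length `L`. -/
def pos (b : Fin (B + 1)) (j : Fin L) : Fin ((B + 1) * L) := finProdFinEquiv (b, j)

theorem pos_injective : Function.Injective fun q : Fin (B + 1) × Fin L => pos q.1 q.2 :=
  fun _ _ h => finProdFinEquiv.injective h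

theorem pos_lt_pos (b : Fin B) (i j : Fin L) : pos b.castSucc i < pos b.succ j := by
  rw [Fin.lt_def]
  simp only [pos, finProdFinEquiv_apply_val, Fin.val_castSucc, Fin.val_succ]
  have := i.is_lt
  rw [mul_add, mul_one]
  omega

/-- The first `a` bits of the block `b`, for a block that is not the last one. -/
def blockHead (ha : a ≤ L) (u : Fin ((B + 1) * L) → Bool) (b : Fin B) : Fin a → Bool :=
  fun i => u (pos b.castSucc (Fin.castLE ha i))

/-- The block that follows the block `b`. -/
def nextBlock (v : Fin ((B + 1) * L) → Bool) (b : Fin B) : Fin L → Bool :=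
  fun j => v (pos b.succ j)

/-- The sequence that carries in each block the encoded head of the preceding block of `u`. -/
def relay (ha : a ≤ L) (φ : (Fin a → Bool) → Fin L → Bool) (u : Fin ((B + 1) * L) → Bool)
    (n : Fin ((B + 1) * L)) : Bool :=
  Fin.cases (motive := fun _ => Bool) false
    (fun b => φ (blockHead ha u b) (finProdFinEquiv.symm n).2) (finProdFinEquiv.symm n).1

theorem relay_pos_succ (ha : a ≤ L) (φ : (Fin a → Bool) → Fin L → Bool)
    (u : Fin ((B + 1) * L) → Bool) (b : Fin B) (j : Fin L) :
    relay ha φ u (pos b.succ j) = φ (blockHead ha u b) j := by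
  simp only [relay, pos, Equiv.symm_apply_apply, Fin.cases_succ]

/-- The relayed sequence is causal. -/
theorem relay_congr (ha : a ≤ L) (φ : (Fin a → Bool) → Fin L → Bool)
    {u u' : Fin ((B + 1) * L) → Bool} {n : Fin ((B + 1) * L)} (h : ∀ k < n, u k = u' k) :
    relay ha φ u n = relay ha φ u' n := by
  obtain ⟨⟨b, j⟩, rfl⟩ := finProdFinEquiv.surjective n
  refine Fin.cases ?_ (fun b h => ?_) b h
  · intro _
    simp only [relay, Equiv.symm_apply_apply, Fin.cases_zero]
  · change relay ha φ u (pos b.succ j) = relay ha φ u' (pos b.succ j)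
    rw [relay_pos_succ, relay_pos_succ]
    congr 1
    funext i
    exact h _ (pos_lt_pos b _ j)

/-- The sequence whose block heads are the rows of `d`, padded by `false`. -/
def spread (d : Fin B × Fin a → Bool) (n : Fin ((B + 1) * L)) : Bool :=
  if h : ((finProdFinEquiv.symm n).1 : ℕ) < B ∧ ((finProdFinEquiv.symm n).2 : ℕ) < a then
    d (⟨_, h.1⟩, ⟨_, h.2⟩)
  else false

theorem blockHead_spread (ha : a ≤ L) (d : Fin B × Fin a → Bool) (b : Fin B) (i : Fin a) :
    blockHead ha (spread d) b i = d (b, i) := by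
  simp [blockHead, spread, pos]

/-- The noise sequence, as far as it is known before time `n` from the codeword `x` and the
feedback `z`. -/
def knownNoise {N : ℕ} (n : Fin N) (x : Fin N → Bool) (z : Fin (n : ℕ) → Bool) (k : Fin N) : Bool :=
  if h : k < n then xor (x k) (z ⟨k, h⟩) else false

/-- The block-Markov code. Transmitters `1` and `3` use the code `(φ₁, ψ₁)` for a binary symmetric
channel for their own messages, and send jointly to receiver `2`, encoded by `φ₂`, the noise of the
preceding block, which they know from the feedback; transmitter `2` sends uncoded bits. -/
noncomputable def blockMarkovCode {a₁ : ℕ} (ha : a ≤ L)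
    (φ₁ : (Fin a₁ → Bool) → Fin ((B + 1) * L) → Bool)
    (ψ₁ : (Fin ((B + 1) * L) → Bool) → Fin a₁ → Bool)
    (φ₂ : (Fin a → Bool) → Fin L → Bool) (ψ₂ : (Fin L → Bool) → Fin a → Bool)
    {M₁ M₂ : ℕ} (m₁ : Fin M₁ ≃ (Fin a₁ → Bool)) (m₂ : Fin M₂ ≃ (Fin B × Fin a → Bool)) :
    FeedbackBlockCode (Bool × Bool) Bool (Bool × Bool) Bool (Bool × Bool) Bool Bool Unit Bool
      M₁ M₂ M₁ ((B + 1) * L) where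
  enc :=
    { f₁ := fun n w z => (φ₁ (m₁ w) n, relay ha φ₂ (knownNoise n (φ₁ (m₁ w)) z) n)
      f₂ := fun n w _ => spread (m₂ w) n
      f₃ := fun n w z => (relay ha φ₂ (knownNoise n (φ₁ (m₁ w)) z) n, φ₁ (m₁ w) n) }
  dec :=
    { g₁ := fun y => m₁.symm (ψ₁ y)
      g₂ := fun y => m₂.symm fun q =>
        xor (blockHead ha (fun n => (y n).1) q.1 q.2) (ψ₂ (nextBlock (fun n => (y n).2) q.1) q.2)
      g₃ := fun y => m₁.symm (ψ₁ y) }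

variable {a₁ : ℕ} (ha : a ≤ L) (φ₁ : (Fin a₁ → Bool) → Fin ((B + 1) * L) → Bool)
    (ψ₁ : (Fin ((B + 1) * L) → Bool) → Fin a₁ → Bool)
    (φ₂ : (Fin a → Bool) → Fin L → Bool) (ψ₂ : (Fin L → Bool) → Fin a → Bool)
    {M₁ M₂ : ℕ} (m₁ : Fin M₁ ≃ (Fin a₁ → Bool)) (m₂ : Fin M₂ ≃ (Fin B × Fin a → Bool))

/-- Both relaying transmitters know the relayed noise bits in time, so that their inputs to receiver
`2` agree and the bit `E` has no effect. -/
theorem run_blockMarkovCode (w : Fin M₁ × Fin M₂ × Fin M₁) (u v e : Fin ((B + 1) * L) → Bool)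
    (n : Fin ((B + 1) * L)) :
    run (blockMarkovCode ha φ₁ ψ₁ φ₂ ψ₂ m₁ m₂).enc w u v e n =
      (xor (φ₁ (m₁ w.1) n) (u n), (xor (spread (m₂ w.2.1) n) (u n),
        xor (relay ha φ₂ u n) (v n)), xor (φ₁ (m₁ w.2.2) n) (u n)) := by
  set y := run (blockMarkovCode ha φ₁ ψ₁ φ₂ ψ₂ m₁ m₂).enc w u v e with hy
  have hrun := isRun_run (blockMarkovCode ha φ₁ ψ₁ φ₂ ψ₂ m₁ m₂).enc w u v e
  rw [← hy] at hrun
  have h1 : ∀ k, (y k).1 = xor (φ₁ (m₁ w.1) k) (u k) := fun k => congrArg (fun y => y.1) (hrun k)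
  have h3 : ∀ k, (y k).2.2 = xor (φ₁ (m₁ w.2.2) k) (u k) :=
    fun k => congrArg (fun y => y.2.2) (hrun k)
  have r1 : relay ha φ₂ (knownNoise n (φ₁ (m₁ w.1)) (past (fun k => (y k).1) n)) n =
      relay ha φ₂ u n := by
    refine relay_congr ha φ₂ fun k hk => ?_
    rw [knownNoise, dif_pos hk]
    change xor _ (y k).1 = _
    simp [h1 k]
  have r3 : relay ha φ₂ (knownNoise n (φ₁ (m₁ w.2.2)) (past (fun k => (y k).2.2) n)) n =
      relay ha φ₂ u n := by
    refine relay_congr ha φ₂ fun k hk => ?_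
    rw [knownNoise, dif_pos hk]
    change xor _ (y k).2.2 = _
    simp [h3 k]
  have h2 : (y n).2.1 = (xor (spread (m₂ w.2.1) n) (u n), xor (relay ha φ₂ u n) (v n)) := by
    rw [hrun n]
    simp only [outputs, Encoders.input, blockMarkovCode, feedback]
    rw [r1, r3]
    simp
  exact Prod.ext (h1 n) (Prod.ext h2 (h3 n))

/-- Receiver `2` obtains the uncoded bits of a block correctly once it has decoded the noise of that
block. -/
theorem component_error_of_decode_ne {w : Fin M₁ × Fin M₂ × Fin M₁} {u v e : Fin ((B + 1) * L) → Bool}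
    (h : (blockMarkovCode ha φ₁ ψ₁ φ₂ ψ₂ m₁ m₂).dec.decode
      (run (blockMarkovCode ha φ₁ ψ₁ φ₂ ψ₂ m₁ m₂).enc w u v e) ≠ w) :
    ψ₁ (xorSeq (φ₁ (m₁ w.1)) u) ≠ m₁ w.1 ∨
      (∃ b, ψ₂ (xorSeq (φ₂ (blockHead ha u b)) (nextBlock v b)) ≠ blockHead ha u b) ∨
      ψ₁ (xorSeq (φ₁ (m₁ w.2.2)) u) ≠ m₁ w.2.2 := by
  by_contra hne
  push Not at hne
  obtain ⟨h1, h2, h3⟩ := hne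
  refine h (Prod.ext ?_ (Prod.ext ?_ ?_))
  · simp only [Decoders.decode, run_blockMarkovCode]
    exact (Equiv.symm_apply_eq _).2 h1
  · simp only [Decoders.decode, run_blockMarkovCode]
    refine (Equiv.symm_apply_eq _).2 (funext fun q => ?_)
    have e1 : nextBlock (fun n => xor (relay ha φ₂ u n) (v n)) q.1 =
        xorSeq (φ₂ (blockHead ha u q.1)) (nextBlock v q.1) := by
      funext j
      simp [nextBlock, xorSeq, relay_pos_succ]
    change xor (blockHead ha (fun n => xor (spread (m₂ w.2.1) n) (u n)) q.1 q.2)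
      (ψ₂ (nextBlock (fun n => xor (relay ha φ₂ u n) (v n)) q.1) q.2) = _
    rw [e1, h2]
    have e2 := blockHead_spread ha (m₂ w.2.1) q.1 q.2
    rw [← show (q.1, q.2) = q from rfl, ← e2]
    simp [blockHead]
  · simp only [Decoders.decode, run_blockMarkovCode]
    exact (Equiv.symm_apply_eq _).2 h3

theorem sum_blocks (p δ : ℝ) (b : Fin B) :
    ∑ u : Fin ((B + 1) * L) → Bool, ∑ v : Fin ((B + 1) * L) → Bool, seqW p u * seqW δ v *
      (if ψ₂ (xorSeq (φ₂ (blockHead ha u b)) (nextBlock v b)) ≠ blockHead ha u b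
        then (1 : ℝ) else 0) = transmissionError p δ φ₂ ψ₂ := by
  have h1 : Function.Injective fun j : Fin L => pos b.succ j := fun i j h =>
    congrArg Prod.snd (@pos_injective B L (b.succ, i) (b.succ, j) h)
  have h2 : Function.Injective fun i : Fin a => pos b.castSucc (Fin.castLE ha i) := fun i j h =>
    Fin.castLE_injective ha
      (congrArg Prod.snd (@pos_injective B L (b.castSucc, _) (b.castSucc, _) h))
  have e1 := fun s => sum_seqW_comp δ _ h1 fun t =>
    if ψ₂ (xorSeq (φ₂ s) t) ≠ s then (1 : ℝ) else 0
  have e2 := sum_seqW_comp p _ h2 fun s => ∑ t, seqW δ t *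
    if ψ₂ (xorSeq (φ₂ s) t) ≠ s then (1 : ℝ) else 0
  simp only [← e1] at e2
  simp only [transmissionError, mul_assoc, ← Finset.mul_sum]
  simp only [← e1]
  exact e2

theorem avg_transmissionError (hM₁ : M₁ = 2 ^ a₁) (p : ℝ) :
    ∑ w, (1 / (M₁ : ℝ)) * ∑ u, seqW p u *
      (if ψ₁ (xorSeq (φ₁ (m₁ w)) u) ≠ m₁ w then (1 : ℝ) else 0) =
      transmissionError (1 / 2) p φ₁ ψ₁ := by
  have h : ∀ s : Fin a₁ → Bool, seqW (1 / 2) s = 1 / (M₁ : ℝ) := by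
    intro s
    have : ∀ b, bw (1 / 2) b = 1 / 2 := by intro b; cases b <;> norm_num [bw]
    simp only [seqW, this, Finset.prod_const, Finset.card_univ, Fintype.card_fin, hM₁]
    simp
  simp only [transmissionError, h, mul_assoc, ← Finset.mul_sum]
  congr 1
  exact m₁.sum_comp fun s => ∑ u, seqW p u * if ψ₁ (xorSeq (φ₁ s) u) ≠ s then (1 : ℝ) else 0

theorem errorProb_blockMarkovCode_le (p δ : unitInterval) (hM₁ : M₁ = 2 ^ a₁) (hM₂ : 0 < M₂) :
    (exampleChannel p δ 0).errorProb (blockMarkovCode ha φ₁ ψ₁ φ₂ ψ₂ m₁ m₂) ≤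
      2 * transmissionError (1 / 2) p φ₁ ψ₁ + B * transmissionError p δ φ₂ ψ₂ := by
  have hM₁' : 0 < M₁ := by rw [hM₁]; positivity
  set E₁ : Fin M₁ → (Fin ((B + 1) * L) → Bool) → ℝ :=
    fun w u => if ψ₁ (xorSeq (φ₁ (m₁ w)) u) ≠ m₁ w then 1 else 0 with hE₁
  set E₂ : Fin B → (Fin ((B + 1) * L) → Bool) → (Fin ((B + 1) * L) → Bool) → ℝ :=
    fun b u v => if ψ₂ (xorSeq (φ₂ (blockHead ha u b)) (nextBlock v b)) ≠ blockHead ha u b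
      then 1 else 0 with hE₂
  have n1 : ∀ w u, 0 ≤ E₁ w u := fun w u => by simp only [hE₁]; positivity
  have n2 : ∀ b u v, 0 ≤ E₂ b u v := fun b u v => by simp only [hE₂]; positivity
  have key : ∀ w : Fin M₁ × Fin M₂ × Fin M₁,
      (noiseE p δ fun u v e => if (blockMarkovCode ha φ₁ ψ₁ φ₂ ψ₂ m₁ m₂).dec.decode
        (run (blockMarkovCode ha φ₁ ψ₁ φ₂ ψ₂ m₁ m₂).enc w u v e) ≠ w then 1 else 0) ≤
      ∑ u, seqW p u * E₁ w.1 u + ∑ u, seqW p u * E₁ w.2.2 u +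
        B * transmissionError p δ φ₂ ψ₂ := by
    intro w
    refine (noiseE_mono (G := fun u v _ => E₁ w.1 u + E₁ w.2.2 u + ∑ b, E₂ b u v) p δ
      fun u v e => ?_).trans (le_of_eq ?_)
    · have s2 : 0 ≤ ∑ b, E₂ b u v := Finset.sum_nonneg fun b _ => n2 b u v
      split_ifs with h
      · rcases component_error_of_decode_ne ha φ₁ ψ₁ φ₂ ψ₂ m₁ m₂ h with h | ⟨b, h⟩ | h
        · have : E₁ w.1 u = 1 := if_pos h
          linarith [n1 w.2.2 u]
        · have : E₂ b u v = 1 := if_pos h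
          have := Finset.single_le_sum (fun b _ => n2 b u v) (Finset.mem_univ b)
          linarith [n1 w.2.2 u, n1 w.1 u]
        · have : E₁ w.2.2 u = 1 := if_pos h
          linarith [n1 w.1 u]
      · linarith [n1 w.2.2 u, n1 w.1 u]
    · have e1 : (noiseE p δ fun u v _ => E₁ w.1 u + E₁ w.2.2 u + ∑ b, E₂ b u v) =
          (noiseE p δ fun u _ _ => E₁ w.1 u) + (noiseE p δ fun u _ _ => E₁ w.2.2 u) +
            noiseE p δ fun u v _ => ∑ b, E₂ b u v := by
        simp only [noiseE, mul_add, Finset.sum_add_distrib]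
      rw [e1, noiseE_fst, noiseE_fst, noiseE_fst_snd]
      congr 1
      have e2 : ∑ u, ∑ v, seqW (p : ℝ) u * seqW (δ : ℝ) v * ∑ b, E₂ b u v =
          ∑ b, ∑ u, ∑ v, seqW (p : ℝ) u * seqW (δ : ℝ) v * E₂ b u v := by
        simp_rw [Finset.mul_sum]
        rw [Finset.sum_comm]
        conv_rhs => rw [Finset.sum_comm]
        rw [Finset.sum_comm]
        refine Finset.sum_congr rfl fun u _ => ?_
        rw [Finset.sum_comm]
      rw [e2]
      have e3 : ∀ b, ∑ u, ∑ v, seqW (p : ℝ) u * seqW (δ : ℝ) v * E₂ b u v =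
          transmissionError p δ φ₂ ψ₂ := fun b => sum_blocks ha φ₂ ψ₂ p δ b
      simp [e3]
  rw [errorProb_eq]
  refine (Finset.sum_le_sum fun w _ => mul_le_mul_of_nonneg_left (key w) (by positivity)).trans ?_
  simp only [mul_add, Finset.sum_add_distrib]
  rw [avg_fst hM₂ hM₁' fun w => ∑ u, seqW p u * E₁ w u,
    avg_thd hM₁' hM₂ fun w => ∑ u, seqW p u * E₁ w u, ← Finset.sum_mul,
    avg_const hM₁' hM₂ hM₁', avg_transmissionError φ₁ ψ₁ m₁ hM₁]
  linarith

end Blocks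

/-- The block-Markov code attains the rates: the number of blocks is chosen first, which makes the
loss of receiver `2` small and, unless `H(p) = 0`, leaves a gap between the entropy of the relayed
noise and the capacity of the channel with noise `N_δ`; then the block length is chosen large. -/
theorem subset_feedbackCapacity (p δ : unitInterval) (h : hb p ≤ 1 - hb δ) :
    {R : ℝ × ℝ × ℝ | R.1 ≤ 1 - hb p ∧ R.2.1 ≤ 1 ∧ R.2.2 ≤ 1 - hb p} ⊆
      (exampleChannel p δ 0).feedbackCapacity := by
  rintro R ⟨hR₁, hR₂, hR₃⟩ η hη
  have hl := Real.log_pos one_lt_two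
  -- each of `B + 1` blocks of length `(B + 1) * m` carries `B * m` uncoded bits, except the last
  obtain ⟨B, hB⟩ := exists_nat_gt (2 / η)
  have hBη : 2 ≤ η * (B + 1) := by
    rw [div_lt_iff₀ hη] at hB
    linarith
  obtain ⟨L₁, hL₁⟩ := exists_channel_code p (by positivity : 0 < η * Real.log 2)
    (by positivity : 0 < η / 4)
  have hη₂ : 0 < η / (2 * (B + 1)) := by positivity
  have hsource : ∃ m₀ : ℕ, ∀ m ≥ m₀, ∃ φ ψ,
      transmissionError (a := B * m) (L := (B + 1) * m) p δ φ ψ ≤ η / (2 * (B + 1)) := by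
    -- relaying only `B * m` of the `(B + 1) * m` noise bits of a block gives no gap if `H(p) = 0`,
    -- but then the noise is deterministic
    rcases (Real.binEntropy_nonneg p.2.1 p.2.2).eq_or_lt with hp | hp
    · refine ⟨0, fun m _ => ?_⟩
      obtain ⟨φ, ψ, hφψ⟩ := transmissionError_eq_zero (a := B * m) (L := (B + 1) * m) p δ hp.symm
      exact ⟨φ, ψ, hφψ.trans_le hη₂.le⟩
    · obtain ⟨L₀, hL₀⟩ := exists_transmissionError_le p δ
        (by positivity : 0 < Real.binEntropy p / (B + 1)) hη₂
      refine ⟨L₀, fun m hm => hL₀ _ (hm.trans (Nat.le_mul_of_pos_left m B.succ_pos)) _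
        (Nat.mul_le_mul_right m B.le_succ) ?_⟩
      rw [hb, hb, le_sub_iff_add_le, ← add_div, div_le_one hl] at h
      push_cast
      have e1 : ((B : ℝ) + 1) * m * (Real.binEntropy p / (B + 1)) = m * Real.binEntropy p := by
        field_simp
      rw [e1]
      have := mul_le_mul_of_nonneg_left h (by positivity : (0 : ℝ) ≤ (B + 1) * m)
      linarith
  obtain ⟨m₀, hm₀⟩ := hsource
  set m := max m₀ L₁ + 1 with hm
  have hmpos : (0 : ℝ) < m := by rw [hm]; positivity
  obtain ⟨φ₂, ψ₂, h₂⟩ := hm₀ m ((le_max_left _ _).trans (Nat.le_succ _))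
  have hNL : L₁ ≤ (B + 1) * ((B + 1) * m) :=
    ((le_max_right m₀ L₁).trans (Nat.le_succ _)).trans
      ((Nat.le_mul_of_pos_left m B.succ_pos).trans (Nat.le_mul_of_pos_left _ B.succ_pos))
  obtain ⟨a₁, ha₁, φ₁, ψ₁, h₁⟩ := hL₁ _ hNL
  have m₁ : Fin (2 ^ a₁) ≃ (Fin a₁ → Bool) :=
    (Fintype.equivFinOfCardEq (by simp)).symm
  have m₂ : Fin (2 ^ (B * (B * m))) ≃ (Fin B × Fin (B * m) → Bool) :=
    (Fintype.equivFinOfCardEq (by simp)).symm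
  have hNpos : (0 : ℝ) < (((B + 1) * ((B + 1) * m) : ℕ) : ℝ) := by
    push_cast
    positivity
  have rate₁ : 1 - hb p - η ≤ 1 / (((B + 1) * ((B + 1) * m) : ℕ) : ℝ) *
      Real.logb 2 ((2 ^ a₁ : ℕ) : ℝ) := by
    rw [Nat.cast_pow, Nat.cast_ofNat, Real.logb_pow, Real.logb_self_eq_one one_lt_two, mul_one,
      one_div_mul_eq_div, le_div_iff₀ hNpos]
    rw [← hb_mul_log] at ha₁
    refine le_of_mul_le_mul_right ?_ hl
    linarith
  refine ⟨2 ^ a₁, 2 ^ (B * (B * m)), 2 ^ a₁, (B + 1) * ((B + 1) * m), by positivity, by positivity,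
    by positivity, by exact_mod_cast hNpos, Or.inl ⟨blockMarkovCode
      (Nat.mul_le_mul_right m B.le_succ) φ₁ ψ₁ φ₂ ψ₂ m₁ m₂, ?_, ?_, ?_, ?_⟩⟩
  · refine (errorProb_blockMarkovCode_le _ φ₁ ψ₁ φ₂ ψ₂ m₁ m₂ p δ rfl (by positivity)).trans ?_
    have : (B : ℝ) * (η / (2 * (B + 1))) ≤ η / 2 := by
      rw [mul_div_assoc', div_le_div_iff₀ (by positivity) (by positivity)]
      nlinarith
    have := mul_le_mul_of_nonneg_left h₂ (Nat.cast_nonneg (α := ℝ) B)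
    linarith
  · linarith
  · rw [Nat.cast_pow, Nat.cast_ofNat, Real.logb_pow, Real.logb_self_eq_one one_lt_two, mul_one,
      one_div_mul_eq_div]
    refine (sub_le_sub_right hR₂ η).trans ?_
    rw [le_div_iff₀ hNpos]
    push_cast
    have h1 : (1 - η) * ((B + 1) * (B + 1)) ≤ (B : ℝ) * B := by nlinarith
    have := mul_le_mul_of_nonneg_right h1 hmpos.le
    linarith
  · linarith

end ICFB

theorem corollary2 (p δ : unitInterval) (h : ICFB.hb p ≤ 1 - ICFB.hb δ) :
    (ICFB.exampleChannel p δ 0).feedbackCapacity =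
      {R : ℝ × ℝ × ℝ | R.1 ≤ 1 - ICFB.hb p ∧ R.2.1 ≤ 1 ∧ R.2.2 ≤ 1 - ICFB.hb p} :=
  (ICFB.feedbackCapacity_subset p δ).antisymm (ICFB.subset_feedbackCapacity p δ h)
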